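/- Setting. A principal chooses an action $a\in\mathbb R$; an agent privately knows the state (her type) $s\in S=[\underline s,\overline s]\subset\mathbb R$. Payoffs are $u_A(a,s)=as+b(a)$ for the agent and $u_P(a,s)=a\,g(s)+\kappa\, b(a)$ for the principal, where $\kappa>0$; $b:\mathbb R\to\mathbb R$ is strictly concave and differentiable with Lipschitz-continuous derivative, and $b(a)/|a|\to-\infty$ as $|a|\to\infty$; $g:S\to\mathbb R$ is continuous, and differentiable on $(\underline s,\overline s)$. The type is distributed according to a probability measure $F$ with support $S$ and with a density $f\ge 0$ that is continuous on $S$ and differentiable on $(\underline s,\overline s)$. A mechanism $m$ assigns to every $s\in S$ a Borel probability measure (lottery) $m(s)$ on $\mathbb R$ such that expected payoffs are integrable: $a$ and $b(a)$ are integrable under each $m(s)$, and $s\mapsto u_A(m(s),s)$ and $s\mapsto u_P(m(s),s)$ are $F$-integrable, where $u_i(m(s'),s)$ denotes the expectation of $u_i(a,s)$ when $a\sim m(s')$. It is incentive compatible if $u_A(m(s),s)\ge u_A(m(s'),s)$ for all $s,s'\in S$, and optimal if it maximizes $\int u_P(m(s),s)\,dF(s)$ among all incentive-compatible mechanisms,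 including stochastic ones. For $A\subseteq S$ closed, delegating to $A$ is optimal if there is an optimal mechanism that gives every type in $A$ her first-best action (the maximizer of $u_A(\cdot,s)$ over $\mathbb R$) for sure, and every other type, for sure, her most preferred action among the first-best actions of the types in $A$. Let $\lambda$ be Lebesgue measure on $S$ plus a unit point mass at each of $\underline s$ and $\overline s$, and let $$\nu(s)=\begin{cases}\kappa f(s)-[g'(s)-\kappa]f(s)-[g(s)-\kappa s]f'(s) & s\in(\underline s,\overline s),\\ [g(\overline s)-\kappa\overline s]f(\overline s)& s=\overline s,\\ [\kappa\underline s-g(\underline s)]f(\underline s)& s=\underline s.\end{cases}$$ Assume that $\nu$ is $\lambda$-integrable, so that $\mu(E)=\int_E\nu\,d\lambda$ is a finite signed measure (this is automatic if $f$ and $g$ are continuously differentiable on $S$). For a Borel set $B$ of positive $\lambda$-measure, $\lambda(\cdot\,|\,B)=\lambda(\cdot\cap B)/\lambda(B)$. Claim. Let $s_1,s_2\in S$ with $s_1<s_2$. Delegating to $[s_1,s_2]$ is optimal if and only if (i) $\nu(s)\ge 0$ for all $s\in[s_1,s_2]$; (ii) $\int_{[s,\overline s]}(x-s)\,\nu(x)\,d\lambda(x\,|\,x\ge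 s_2)\le 0$ for all $s\in[s_2,\overline s]$, with equality for $s=s_2$; and (iii) $\int_{[\underline s,s]}(s-x)\,\nu(x)\,d\lambda(x\,|\,x\le s_1)\le 0$ for all $s\in[\underline s,s_1]$, with equality for $s=s_1$. -/

import Mathlib

open MeasureTheory Set Filter
open scoped NNReal

noncomputable section

/-- The primitives of the one-dimensional delegation model: the action is a real number, the type
space is `S = [lo, hi]`, payoffs are `u_A(a, s) = a * s + b a` and `u_P(a, s) = a * g s + κ * b a`,
and the type has distribution `F` with density `f` and support `S`. The functions `g` and `f` matter
on `S` only; their values elsewhere are irrelevant. -/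
structure DelegationModel where
  /-- lowest type -/
  lo : ℝ
  /-- highest type -/
  hi : ℝ
  /-- the action cost/benefit term, common to both payoffs -/
  b : ℝ → ℝ
  b_strictConcave : StrictConcaveOn ℝ univ b
  b_differentiable : Differentiable ℝ b
  b_deriv_lipschitz : ∃ K : ℝ≥0, LipschitzWith K (deriv b)
  b_coercive : Tendsto (fun a => b a / |a|) (Bornology.cobounded ℝ) atBot
  /-- the principal's preferred trade-off as a function of the type -/
  g : ℝ → ℝ
  g_continuousOn : ContinuousOn g (Icc lo hi)
  g_differentiableOn : DifferentiableOn ℝ g (Ioo lo hi)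
  /-- the principal's weight on `b` -/
  κ : ℝ
  κ_pos : 0 < κ
  /-- the distribution of the type -/
  F : Measure ℝ
  F_isProbabilityMeasure : IsProbabilityMeasure F
  /-- the density of `F` -/
  f : ℝ → ℝ
  f_nonneg : ∀ s ∈ Icc lo hi, 0 ≤ f s
  f_continuousOn : ContinuousOn f (Icc lo hi)
  f_differentiableOn : DifferentiableOn ℝ f (Ioo lo hi)
  F_eq : F = (volume.restrict (Icc lo hi)).withDensity (fun s => ENNReal.ofReal (f s))
  F_support : F.support = Icc lo hi

namespace DelegationModel

variable (M : DelegationModel)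

/-- The type space. -/
def S : Set ℝ := Icc M.lo M.hi

/-- The agent's payoff from action `a` in state `s`. -/
def uA (a s : ℝ) : ℝ := a * s + M.b a

/-- The principal's payoff from action `a` in state `s`. -/
def uP (a s : ℝ) : ℝ := a * M.g s + M.κ * M.b a

/-- The agent's expected payoff from the lottery `p` over actions in state `s`. -/
def expUA (p : ProbabilityMeasure ℝ) (s : ℝ) : ℝ := ∫ a, M.uA a s ∂(p : Measure ℝ)

/-- The principal's expected payoff from the lottery `p` over actions in state `s`. -/
def expUP (p : ProbabilityMeasure ℝ) (s : ℝ) : ℝ := ∫ a, M.uP a s ∂(p : Measure ℝ)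

/-- A mechanism assigns to every type in `S` a lottery over actions (values of `m` outside `S` play
no role), such that expected payoffs are integrable: each lottery gives finite expectations to `a`
and to `b a`, and the resulting expected payoffs are integrable over types. -/
structure IsMechanism (m : ℝ → ProbabilityMeasure ℝ) : Prop where
  integrable_action : ∀ s ∈ M.S, Integrable (fun a : ℝ => a) (m s : Measure ℝ)
  integrable_b : ∀ s ∈ M.S, Integrable M.b (m s : Measure ℝ)
  integrable_uA : Integrable (fun s => M.expUA (m s) s) M.F
  integrable_uP : Integrable (fun s => M.expUP (m s) s) M.F

/-- Incentive compatibility: no type in `S` gains by reporting another type in `S`. -/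
def IsIncentiveCompatible (m : ℝ → ProbabilityMeasure ℝ) : Prop :=
  ∀ s ∈ M.S, ∀ s' ∈ M.S, M.expUA (m s') s ≤ M.expUA (m s) s

/-- The principal's expected payoff from a mechanism. -/
def payoff (m : ℝ → ProbabilityMeasure ℝ) : ℝ := ∫ s, M.expUP (m s) s ∂M.F

/-- A mechanism is optimal if it is incentive compatible and no incentive-compatible (possibly
stochastic) mechanism gives the principal a higher expected payoff. -/
def IsOptimal (m : ℝ → ProbabilityMeasure ℝ) : Prop :=
  (M.IsMechanism m ∧ M.IsIncentiveCompatible m) ∧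
    ∀ m' : ℝ → ProbabilityMeasure ℝ, M.IsMechanism m' → M.IsIncentiveCompatible m' →
      M.payoff m' ≤ M.payoff m

/-- `a` is a most preferred action of type `s` in the set `D` of actions. -/
def IsBestIn (D : Set ℝ) (s a : ℝ) : Prop := a ∈ D ∧ ∀ a' ∈ D, M.uA a' s ≤ M.uA a s

/-- `a` is a first-best action of type `s`. -/
def IsFirstBest (s a : ℝ) : Prop := M.IsBestIn univ s a

/-- The first-best actions of the types in `A`. -/
def firstBestActions (A : Set ℝ) : Set ℝ := {a | ∃ t ∈ A, M.IsFirstBest t a}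

/-- Delegating to `A` is optimal: there is an optimal mechanism in which every type in `A` gets her
first-best action for sure, and every other type gets for sure her most preferred action among the
first-best actions of the types in `A`. -/
def DelegatingIsOptimal (A : Set ℝ) : Prop :=
  ∃ m : ℝ → ProbabilityMeasure ℝ, M.IsOptimal m ∧
    (∀ s ∈ A, ∃ a, M.IsFirstBest s a ∧ (m s : Measure ℝ) = Measure.dirac a) ∧
    (∀ s ∈ M.S \ A, ∃ a, M.IsBestIn (M.firstBestActions A) s a ∧
      (m s : Measure ℝ) = Measure.dirac a)

/-- The function `ν`: `κ f - (g' - κ) f - (g - κ s) f'` in the interior of `S`, and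
`(g - κ s) f` times the outward normal (`1` at `hi`, `-1` at `lo`) on the boundary. Only its values
on `S` are used. -/
def nu (s : ℝ) : ℝ :=
  if s = M.hi then (M.g M.hi - M.κ * M.hi) * M.f M.hi
  else if s = M.lo then (M.κ * M.lo - M.g M.lo) * M.f M.lo
  else M.κ * M.f s - (deriv M.g s - M.κ) * M.f s - (M.g s - M.κ * s) * deriv M.f s

/-- The measure `λ`: Lebesgue measure on `S` plus the counting (zero-dimensional Hausdorff) measure
on the boundary `{lo, hi}` of `S`. -/
def lam : Measure ℝ :=
  volume.restrict M.S + (Measure.dirac M.lo + Measure.dirac M.hi)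

end DelegationModel

end

/-! Under incentive compatibility a mechanism, stochastic or not, matters only through the agent's
indirect utility `V`, which is convex, and the mean action `α`, a subgradient of `V`. Integration by
parts turns the principal's payoff into the linear expression `∫ α * tail + κ * V lo`. Here `tail`
is continuous with derivative `-ν` inside `S`, and the atoms of `μ` are `tail hi` and `κ - tail lo`.
Conditions (ii) and (iii) say that `tail` on `[s₂, hi]` and `κ - tail` on `[lo, s₁]` have zero
integral, with nonpositive integrals over `[s, hi]` and `[lo, s]` respectively
(`tailConditions_iff`).

Sufficiency (`TailConditions.payoff_le`): by `integral_mul_tail_eq_add` the payoff is a sum of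
values of `V` on `[s₁, s₂]` with nonnegative weights, where `V` is at most the first-best utility,
and of two outer integrals of the monotone `α`, nonpositive by `integral_monotoneOn_mul_nonpos`.
Delegation attains every bound.

Necessity (`DelegatingIsOptimal.tailConditions`): three deterministic deviations are tested.
Offering one more action beyond an end of the interval gives the inequalities in (ii) and (iii).
Trimming the interval at one end, by less and less, gives the equalities and the signs of the atoms.
Deleting a small gap around an interior point `c` would pay if `ν c < 0`. -/

/-! ### Convex functions through their subgradients -/

/-- `α s` is a subgradient of `V` at `s`, relative to `[x, y]`, for every `s ∈ [x, y]`. -/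
def IsSubgradientOn (x y : ℝ) (V α : ℝ → ℝ) : Prop :=
  ∀ s ∈ Icc x y, ∀ t ∈ Icc x y, V s + α s * (t - s) ≤ V t

namespace IsSubgradientOn

variable {x y : ℝ} {V α : ℝ → ℝ}

theorem mono (h : IsSubgradientOn x y V α) {x' y' : ℝ} (hx : x ≤ x') (hy : y' ≤ y) :
    IsSubgradientOn x' y' V α := fun s hs t ht =>
  h s ⟨hx.trans hs.1, hs.2.trans hy⟩ t ⟨hx.trans ht.1, ht.2.trans hy⟩

theorem monotoneOn (h : IsSubgradientOn x y V α) : MonotoneOn α (Icc x y) := by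
  intro s hs t ht hst
  rcases hst.eq_or_lt with rfl | hlt
  · rfl
  have h1 := h s hs t ht
  have h2 := h t ht s hs
  by_contra! hc
  nlinarith [mul_pos (sub_pos.2 hlt) (sub_pos.2 hc)]

/-- The subgradient inequalities at `s` and at `t` bound the first-order error from both sides;
hence `V` is differentiable wherever `α` is continuous. -/
theorem abs_sub_le (h : IsSubgradientOn x y V α) {s t : ℝ} (hs : s ∈ Icc x y) (ht : t ∈ Icc x y) :
    |V t - V s - α s * (t - s)| ≤ |α t - α s| * |t - s| := by
  have h1 := h s hs t ht
  have h2 := h t ht s hs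
  rw [abs_of_nonneg (by linarith), ← abs_mul]
  refine le_trans ?_ (le_abs_self _)
  nlinarith

theorem continuousOn (h : IsSubgradientOn x y V α) : ContinuousOn V (Icc x y) := by
  rcases lt_or_ge y x with hxy | hxy
  · simp [Icc_eq_empty hxy.not_ge]
  have hm := h.monotoneOn
  obtain ⟨C, hC⟩ : ∃ C, ∀ s ∈ Icc x y, |α s| ≤ C := by
    refine ⟨max |α x| |α y|, fun s hs => ?_⟩
    have h1 := hm (left_mem_Icc.2 hxy) hs hs.1
    have h2 := hm hs (right_mem_Icc.2 hxy) hs.2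
    exact abs_le_max_abs_abs h1 h2
  have hlip : LipschitzOnWith (Real.toNNReal C) V (Icc x y) := by
    refine LipschitzOnWith.of_dist_le_mul fun s hs t ht => ?_
    have h1 := h s hs t ht
    have h2 := h t ht s hs
    have hC0 : 0 ≤ C := (abs_nonneg _).trans (hC s hs)
    rw [Real.coe_toNNReal _ hC0, Real.dist_eq, Real.dist_eq]
    have e1 : |α s * (t - s)| ≤ C * |s - t| := by
      rw [abs_mul, abs_sub_comm t s]; exact mul_le_mul_of_nonneg_right (hC s hs) (abs_nonneg _)
    have e2 : |α t * (s - t)| ≤ C * |s - t| := by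
      rw [abs_mul]; exact mul_le_mul_of_nonneg_right (hC t ht) (abs_nonneg _)
    rw [abs_le] at *
    constructor <;> linarith [e1.1, e1.2, e2.1, e2.2]
  exact hlip.continuousOn

/-- The exceptional set is that of the discontinuities of the monotone `α`, which is countable. -/
theorem exists_countable_hasDerivAt (h : IsSubgradientOn x y V α) :
    ∃ C : Set ℝ, C.Countable ∧ ∀ s ∈ Ioo x y \ C, HasDerivAt V (α s) s := by
  refine ⟨_, h.monotoneOn.countable_not_continuousWithinAt, fun s hs => ?_⟩
  have hsI : s ∈ Icc x y := Ioo_subset_Icc_self hs.1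
  have hnhds : Icc x y ∈ nhds s := Icc_mem_nhds hs.1.1 hs.1.2
  have hc : ContinuousAt α s := by
    have : ContinuousWithinAt α (Icc x y) s := by
      by_contra hcon
      exact hs.2 ⟨hsI, hcon⟩
    exact this.continuousAt hnhds
  rw [hasDerivAt_iff_isLittleO, Asymptotics.isLittleO_iff]
  intro c hc0
  have hev : ∀ᶠ t in nhds s, |α t - α s| < c := by
    have := Metric.tendsto_nhds.1 hc c hc0
    simpa [Real.dist_eq] using this
  filter_upwards [hev, hnhds] with t ht htI
  have := h.abs_sub_le hsI htI
  rw [Real.norm_eq_abs, Real.norm_eq_abs, smul_eq_mul, mul_comm (t - s)]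
  exact this.trans (mul_le_mul_of_nonneg_right ht.le (abs_nonneg _))

theorem intervalIntegrable (h : IsSubgradientOn x y V α) (hxy : x ≤ y) :
    IntervalIntegrable α volume x y :=
  MonotoneOn.intervalIntegrable (by rw [uIcc_of_le hxy]; exact h.monotoneOn)

/-- Integration by parts. -/
theorem integral_mul_add (h : IsSubgradientOn x y V α) (hxy : x ≤ y) {W W' : ℝ → ℝ}
    (hW : ContinuousOn W (Icc x y)) (hd : ∀ s ∈ Ioo x y, HasDerivAt W (W' s) s)
    (hi : IntervalIntegrable W' volume x y) :
    ∫ s in x..y, (α s * W s + V s * W' s) = V y * W y - V x * W x := by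
  obtain ⟨C, hC, hV⟩ := h.exists_countable_hasDerivAt
  refine integral_eq_of_hasDerivAt_off_countable_of_le (fun s => V s * W s) _ hxy hC
    (h.continuousOn.mul hW) (fun s hs => (hV s hs).mul (hd s hs.1)) ?_
  refine ((h.intervalIntegrable hxy).mul_continuousOn (by rwa [uIcc_of_le hxy])).add
    (hi.continuousOn_mul (by rw [uIcc_of_le hxy]; exact h.continuousOn))

theorem integral_eq_sub (h : IsSubgradientOn x y V α) (hxy : x ≤ y) :
    ∫ s in x..y, α s = V y - V x := by
  have := h.integral_mul_add hxy (W := fun _ => 1) (W' := fun _ => 0) continuousOn_const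
    (fun s _ => hasDerivAt_const s _) (by simp)
  simpa using this

end IsSubgradientOn

/-! ### Sign lemmas for integrals with ordered tails -/

/-- A monotone function integrates nonpositively against a function with zero integral whose upper
tails integrate nonpositively. -/
theorem integral_monotoneOn_mul_nonpos {x y : ℝ} (hxy : x ≤ y) {α N : ℝ → ℝ}
    (hα : MonotoneOn α (Icc x y)) (hN : ContinuousOn N (Icc x y))
    (htail : ∀ t ∈ Icc x y, ∫ s in t..y, N s ≤ 0) (h0 : ∫ s in x..y, N s = 0) :
    ∫ s in x..y, α s * N s ≤ 0 := by
  -- A globally monotone extension is measurable, as Fubini requires.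
  obtain ⟨β, hβ, hαβ⟩ := hα.exists_monotone_extension
    ⟨α x, forall_mem_image.2 fun s hs => hα (left_mem_Icc.2 hxy) hs hs.1⟩
    ⟨α y, forall_mem_image.2 fun s hs => hα hs (right_mem_Icc.2 hxy) hs.2⟩
  set A := β x
  set B := β y
  have hAB : A ≤ B := hβ hxy
  have hNi : IntervalIntegrable N volume x y :=
    ContinuousOn.intervalIntegrable (by rwa [uIcc_of_le hxy])
  have hNI : IntegrableOn N (Ioc x y) := (intervalIntegrable_iff_integrableOn_Ioc_of_le hxy).1 hNi
  have hset : MeasurableSet {p : ℝ × ℝ | p.2 < β p.1} :=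
    measurableSet_lt measurable_snd (hβ.measurable.comp measurable_fst)
  have hprod : Integrable (fun p : ℝ × ℝ => indicator {p : ℝ × ℝ | p.2 < β p.1}
      (fun p => N p.1) p) ((volume.restrict (Ioc x y)).prod (volume.restrict (Ioc A B))) :=
    (Integrable.comp_fst hNI _).indicator hset
  have hswap := integral_integral_swap (f := fun s r => indicator {p : ℝ × ℝ | p.2 < β p.1}
      (fun p => N p.1) (s, r)) hprod
  -- Layer-cake formula: `α s - A` is the length of the set of levels `r > A` below `β s`. After
  -- swapping the integrals, each level contributes the integral of `N` over `{s | r < β s}`.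
  have hinner : ∀ s ∈ Ioc x y, ∫ r in Ioc A B, indicator {p : ℝ × ℝ | p.2 < β p.1}
      (fun p => N p.1) (s, r) = (α s - A) * N s := by
    intro s hs
    have hsI : s ∈ Icc x y := ⟨hs.1.le, hs.2⟩
    have e : ∀ r, indicator {p : ℝ × ℝ | p.2 < β p.1} (fun p => N p.1) (s, r)
        = indicator (Iio (β s)) (fun _ => N s) r := by
      intro r; simp [indicator]
    simp_rw [e]
    rw [setIntegral_indicator measurableSet_Iio]
    have e2 : Ioc A B ∩ Iio (β s) = Ioo A (β s) := by
      ext r; simp only [mem_inter_iff, mem_Ioc, mem_Iio, mem_Ioo]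
      constructor
      · rintro ⟨⟨h1, _⟩, h3⟩; exact ⟨h1, h3⟩
      · rintro ⟨h1, h3⟩; exact ⟨⟨h1, (h3.trans_le (hβ hs.2)).le⟩, h3⟩
    rw [e2, setIntegral_const, smul_eq_mul, hαβ hsI, measureReal_def, Real.volume_Ioo,
      ENNReal.toReal_ofReal (sub_nonneg.2 (hβ hs.1.le))]
  have houter : ∀ r, ∫ s in Ioc x y, indicator {p : ℝ × ℝ | p.2 < β p.1}
      (fun p => N p.1) (s, r) ≤ 0 := by
    intro r
    have e : ∀ s, indicator {p : ℝ × ℝ | p.2 < β p.1} (fun p => N p.1) (s, r)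
        = indicator {s | r < β s} N s := by
      intro s; simp [indicator]
    simp_rw [e]
    have hU : MeasurableSet {s | r < β s} := measurableSet_lt measurable_const hβ.measurable
    rw [setIntegral_indicator hU]
    by_cases hne : (Ioc x y ∩ {s | r < β s}).Nonempty
    · set E := Ioc x y ∩ {s | r < β s} with hE
      have hbdd : BddBelow E := ⟨x, fun s hs => hs.1.1.le⟩
      set t := sInf E
      have htx : x ≤ t := le_csInf hne fun s hs => hs.1.1.le
      obtain ⟨s0, hs0⟩ := hne
      have hty : t ≤ y := (csInf_le hbdd hs0).trans hs0.1.2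
      -- A superlevel set of a monotone function is an upper tail up to its left endpoint, so
      -- `htail` applies.
      have hae : E =ᵐ[volume] Ioc t y := by
        have hsub1 : Ioc t y ⊆ E := by
          intro s hs
          obtain ⟨s1, hs1, hlt⟩ := exists_lt_of_csInf_lt ⟨s0, hs0⟩ hs.1
          exact ⟨⟨htx.trans_lt hs.1, hs.2⟩, lt_of_lt_of_le hs1.2 (hβ hlt.le)⟩
        have hsub2 : E ⊆ Icc t y := fun s hs => ⟨csInf_le hbdd hs, hs.1.2⟩
        refine EventuallyLE.antisymm ?_ (LE.le.eventuallyLE hsub1)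
        exact (LE.le.eventuallyLE hsub2).trans Ioc_ae_eq_Icc.symm.le
      rw [setIntegral_congr_set hae, ← intervalIntegral.integral_of_le hty]
      exact htail t ⟨htx, hty⟩
    · rw [not_nonempty_iff_eq_empty.1 hne]; simp
  have key : ∫ s in x..y, (α s - A) * N s ≤ 0 := by
    rw [intervalIntegral.integral_of_le hxy, ← setIntegral_congr_fun measurableSet_Ioc hinner, hswap]
    exact integral_nonpos houter
  have hαN : IntervalIntegrable (fun s => α s * N s) volume x y :=
    (MonotoneOn.intervalIntegrable (by rwa [uIcc_of_le hxy])).mul_continuousOn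
      (by rwa [uIcc_of_le hxy])
  -- The baseline `A` drops out because `N` has zero integral.
  have e : ∫ s in x..y, (α s - A) * N s = ∫ s in x..y, α s * N s := by
    simp_rw [sub_mul]
    rw [intervalIntegral.integral_sub hαN (hNi.const_mul A), intervalIntegral.integral_const_mul, h0]
    ring
  linarith

theorem nonneg_left_of_integral_nonneg {x y : ℝ} (hxy : x < y) {N : ℝ → ℝ}
    (hN : ContinuousOn N (Icc x y)) (h : ∀ t ∈ Icc x y, 0 ≤ ∫ s in x..t, N s) : 0 ≤ N x := by
  by_contra! hneg
  have hc : ContinuousWithinAt N (Icc x y) x := hN x (left_mem_Icc.2 hxy.le)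
  have hev : ∀ᶠ s in nhdsWithin x (Icc x y), N s < 0 := hc.eventually_lt_const hneg
  rw [nhdsWithin_Icc_eq_nhdsGE hxy] at hev
  obtain ⟨u, hu, hsub⟩ := (mem_nhdsGE_iff_exists_Icc_subset).1 hev
  have htI : min u y ∈ Icc x y := ⟨le_min (le_of_lt hu) hxy.le, min_le_right _ _⟩
  have hlt : x < min u y := lt_min hu hxy
  have h1 := h _ htI
  have hint : IntervalIntegrable (fun s => - N s) volume x (min u y) := by
    refine ContinuousOn.intervalIntegrable ?_
    rw [uIcc_of_le hlt.le]
    exact (hN.mono (Icc_subset_Icc_right htI.2)).neg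
  have h2 := intervalIntegral.intervalIntegral_pos_of_pos_on hint (fun s hs => by
    have : N s < 0 := hsub ⟨hs.1.le, hs.2.le.trans (min_le_left _ _)⟩
    linarith) hlt
  rw [intervalIntegral.integral_neg] at h2
  linarith

theorem nonneg_right_of_integral_nonneg {x y : ℝ} (hxy : x < y) {N : ℝ → ℝ}
    (hN : ContinuousOn N (Icc x y)) (h : ∀ t ∈ Icc x y, 0 ≤ ∫ s in t..y, N s) : 0 ≤ N y := by
  have := nonneg_left_of_integral_nonneg (x := -y) (y := -x) (neg_lt_neg hxy) (N := fun s => N (-s))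
    (hN.comp continuous_neg.continuousOn fun s hs => ⟨by linarith [hs.2], by linarith [hs.1]⟩)
    (fun t ht => by
      rw [intervalIntegral.integral_comp_neg, neg_neg]
      exact h _ ⟨by linarith [ht.2], by linarith [ht.1]⟩)
  simpa using this

/-! ### First-best actions and the agent's choice from intervals -/

namespace DelegationModel

variable (M : DelegationModel)

theorem continuous_b : Continuous M.b := M.b_differentiable.continuous

theorem strictAnti_deriv_b : StrictAnti (deriv M.b) := by
  have := M.b_strictConcave.strictAntiOn_deriv (fun x _ => M.b_differentiable x)
  exact fun x y h => this (mem_univ x) (mem_univ y) h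

theorem continuous_uA (s : ℝ) : Continuous (fun a => M.uA a s) :=
  (continuous_id.mul continuous_const).add M.continuous_b

theorem tendsto_uA (s : ℝ) : Tendsto (fun a => M.uA a s) (Bornology.cobounded ℝ) atBot := by
  have habs : Tendsto (fun a : ℝ => |a|) (Bornology.cobounded ℝ) atTop := tendsto_norm_cobounded_atTop
  have h1 : Tendsto (fun a => |s| + M.b a / |a|) (Bornology.cobounded ℝ) atBot :=
    tendsto_atBot_add_const_left _ _ M.b_coercive
  refine tendsto_atBot_mono' _ ?_ (habs.atTop_mul_atBot₀ h1)
  filter_upwards [habs.eventually_gt_atTop 0] with a ha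
  rw [mul_add, mul_div_cancel₀ _ ha.ne', ← abs_mul, uA]
  linarith [le_abs_self (a * s)]

theorem exists_isFirstBest (s : ℝ) : ∃ a, M.IsFirstBest s a := by
  obtain ⟨a, ha⟩ := (M.continuous_uA s).exists_forall_ge
    (by rw [← Metric.cobounded_eq_cocompact]; exact M.tendsto_uA s)
  exact ⟨a, mem_univ _, fun a' _ => ha a'⟩

/-- The first-best action of type `s`. -/
noncomputable def best (s : ℝ) : ℝ := (M.exists_isFirstBest s).choose

theorem best_spec (s : ℝ) : M.IsFirstBest s (M.best s) := (M.exists_isFirstBest s).choose_spec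

theorem uA_le_best (a s : ℝ) : M.uA a s ≤ M.uA (M.best s) s := (M.best_spec s).2 a (mem_univ _)

theorem IsFirstBest.deriv_eq {M : DelegationModel} {s a : ℝ} (h : M.IsFirstBest s a) :
    deriv M.b a = -s := by
  have hmax : IsLocalMax (fun a => M.uA a s) a := Eventually.of_forall fun a' => h.2 a' (mem_univ _)
  have hd : HasDerivAt (fun a => M.uA a s) (1 * s + deriv M.b a) a :=
    ((hasDerivAt_id a).mul_const s).add (M.b_differentiable a).hasDerivAt
  have := hmax.hasDerivAt_eq_zero hd
  linarith

theorem deriv_best (s : ℝ) : deriv M.b (M.best s) = -s := (M.best_spec s).deriv_eq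

theorem IsFirstBest.eq_best {M : DelegationModel} {s a : ℝ} (h : M.IsFirstBest s a) :
    a = M.best s :=
  M.strictAnti_deriv_b.injective (by rw [h.deriv_eq, deriv_best])

/-- Every real action is the first best of some real type, possibly outside `S`, so actions can be
labelled by types; monotonicity and surjectivity then make `best` continuous. -/
theorem best_neg_deriv (a : ℝ) : M.best (-deriv M.b a) = a :=
  M.strictAnti_deriv_b.injective (by rw [deriv_best, neg_neg])

theorem best_strictMono : StrictMono M.best := fun s t h =>
  M.strictAnti_deriv_b.lt_iff_gt.1 (by rw [deriv_best, deriv_best]; linarith)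

theorem best_surjective : Function.Surjective M.best := fun a => ⟨_, M.best_neg_deriv a⟩

theorem continuous_best : Continuous M.best :=
  M.best_strictMono.monotone.continuous_of_surjective M.best_surjective

/-- The payoff of type `x` from the first-best action of type `t`. -/
noncomputable def tang (t x : ℝ) : ℝ := M.uA (M.best t) x

/-- In its second argument `tang t` is affine with slope `best t`: it is the tangent at `t` to the
convex first-best utility `x ↦ tang x x`. The comparisons below all come from this picture. -/
theorem tang_eq (t x y : ℝ) : M.tang t x = M.tang t y + M.best t * (x - y) := by
  simp only [tang, uA]; ring

theorem tang_le (t x : ℝ) : M.tang t x ≤ M.tang x x := M.uA_le_best _ _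

theorem tang_lt {t x : ℝ} (h : t ≠ x) : M.tang t x < M.tang x x := by
  refine (M.tang_le t x).lt_of_ne fun he => h ?_
  have : M.IsFirstBest x (M.best t) := ⟨mem_univ _, fun a _ => (M.uA_le_best a x).trans_eq he.symm⟩
  exact M.best_strictMono.injective this.eq_best

theorem tang_mono_left {t t' x : ℝ} (h : t ≤ t') (hx : t' ≤ x) : M.tang t x ≤ M.tang t' x := by
  rw [M.tang_eq t x t', M.tang_eq t' x t']
  have := M.tang_le t t'
  have := M.best_strictMono.monotone h
  nlinarith

theorem tang_lt_of_lt_of_le {t t' x : ℝ} (h : t < t') (hx : t' ≤ x) : M.tang t x < M.tang t' x := by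
  rw [M.tang_eq t x t', M.tang_eq t' x t']
  have := M.tang_lt h.ne
  have := M.best_strictMono h
  nlinarith

theorem tang_anti_right {t t' x : ℝ} (h : t ≤ t') (hx : x ≤ t) : M.tang t' x ≤ M.tang t x := by
  rw [M.tang_eq t x t, M.tang_eq t' x t]
  have := M.tang_le t' t
  have := M.best_strictMono.monotone h
  nlinarith

theorem tang_lt_of_lt_of_ge {t t' x : ℝ} (h : t < t') (hx : x ≤ t) : M.tang t' x < M.tang t x := by
  rw [M.tang_eq t x t, M.tang_eq t' x t]
  have := M.tang_lt h.ne'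
  have := M.best_strictMono h
  nlinarith

theorem continuous_tang (x : ℝ) : Continuous fun t => M.tang t x :=
  (M.continuous_uA x).comp M.continuous_best

/-- The intermediate value theorem applies because `tang u x` falls from `tang x x` to `-∞` as `u`
grows. This supplies the actions that make a chosen type indifferent. -/
theorem exists_tang_eq_right {x y : ℝ} (h : y < M.tang x x) : ∃ u, x < u ∧ M.tang u x = y := by
  have h1 : Tendsto (fun a => M.uA a x) atTop atBot :=
    (M.tendsto_uA x).mono_left (by rw [IsOrderBornology.cobounded_eq]; exact le_sup_right)
  obtain ⟨a, ha, hax⟩ := ((h1.eventually_le_atBot y).and (eventually_ge_atTop (M.best x))).exists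
  obtain ⟨v, rfl⟩ := M.best_surjective a
  have hxv : x ≤ v := M.best_strictMono.le_iff_le.1 hax
  obtain ⟨u, hu, hux⟩ := intermediate_value_Icc' hxv (M.continuous_tang x).continuousOn ⟨ha, h.le⟩
  refine ⟨u, hu.1.lt_of_ne ?_, hux⟩
  rintro rfl
  exact h.ne' hux

theorem exists_tang_eq_left {x y : ℝ} (h : y < M.tang x x) : ∃ u, u < x ∧ M.tang u x = y := by
  have h1 : Tendsto (fun a => M.uA a x) atBot atBot :=
    (M.tendsto_uA x).mono_left (by rw [IsOrderBornology.cobounded_eq]; exact le_sup_left)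
  obtain ⟨a, ha, hax⟩ := ((h1.eventually_le_atBot y).and (eventually_le_atBot (M.best x))).exists
  obtain ⟨v, rfl⟩ := M.best_surjective a
  have hxv : v ≤ x := M.best_strictMono.le_iff_le.1 hax
  obtain ⟨u, hu, hux⟩ := intermediate_value_Icc hxv (M.continuous_tang x).continuousOn ⟨ha, h.le⟩
  refine ⟨u, hu.2.lt_of_ne ?_, hux⟩
  rintro rfl
  exact h.ne' hux

theorem tang_le_clamp {p q y : ℝ} (hy : y ∈ Icc p q) (x : ℝ) :
    M.tang y x ≤ M.tang (max p (min x q)) x := by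
  rcases le_total x p with hp | hp
  · rw [max_eq_left ((min_le_left _ _).trans hp)]
    exact M.tang_anti_right hy.1 hp
  rcases le_total x q with hq | hq
  · rw [min_eq_left hq, max_eq_right hp]
    exact M.tang_le _ _
  · rw [min_eq_right hq, max_eq_right (hy.1.trans hy.2)]
    exact M.tang_mono_left hy.2 hq

/-- The type whose first-best action type `x` gets when the first-best actions of the types in
`[p, q]` and in `[r, w]` are available and the types on the two sides of `c` pick from different
intervals. -/
noncomputable def split (p q c r w x : ℝ) : ℝ :=
  if x < c then max p (min x q) else max r (min x w)

/-- Type `c` is indifferent between the facing endpoints `q` and `r`. The tangents there cross at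
`c` with ordered slopes, so lower types stay on the left interval and higher types on the right one.
-/
theorem tang_split_le {p q c r w : ℝ} (hpq : p ≤ q) (hqc : q ≤ c) (hcr : c ≤ r) (hrw : r ≤ w)
    (hc : M.tang q c = M.tang r c) (x y : ℝ) :
    M.tang (split p q c r w y) x ≤ M.tang (split p q c r w x) x := by
  have hq : ∀ z, max p (min z q) ∈ Icc p q := fun z => ⟨le_max_left _ _, max_le hpq (min_le_right _ _)⟩
  have hr : ∀ z, max r (min z w) ∈ Icc r w := fun z => ⟨le_max_left _ _, max_le hrw (min_le_right _ _)⟩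
  have hb : M.best q ≤ M.best r := M.best_strictMono.monotone (hqc.trans hcr)
  unfold split
  split_ifs with hy hx hx
  · exact M.tang_le_clamp (hq y) x
  · push Not at hx
    calc M.tang (max p (min y q)) x ≤ M.tang q x := M.tang_mono_left (hq y).2 (hqc.trans hx)
      _ ≤ M.tang r x := by rw [M.tang_eq q x c, M.tang_eq r x c, hc]; nlinarith
      _ ≤ _ := M.tang_le_clamp ⟨le_rfl, hrw⟩ x
  · calc M.tang (max r (min y w)) x ≤ M.tang r x := M.tang_anti_right (hr y).1 (hx.le.trans hcr)
      _ ≤ M.tang q x := by rw [M.tang_eq q x c, M.tang_eq r x c, hc]; nlinarith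
      _ ≤ _ := M.tang_le_clamp ⟨hpq, le_rfl⟩ x
  · exact M.tang_le_clamp (hr y) x

theorem isSubgradientOn_tang {τ : ℝ → ℝ} (hτ : ∀ x y, M.tang (τ y) x ≤ M.tang (τ x) x) (x y : ℝ) :
    IsSubgradientOn x y (fun s => M.tang (τ s) s) (fun s => M.best (τ s)) := by
  intro s _ t _
  have := hτ t s
  rw [M.tang_eq _ t s] at this
  exact this

/-- Single-peakedness is strict, so delegation to an interval pins down the action of every type. -/
theorem IsBestIn.eq_best_clamp {M : DelegationModel} {p q s a : ℝ} (hpq : p ≤ q)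
    (h : M.IsBestIn (M.firstBestActions (Icc p q)) s a) : a = M.best (max p (min s q)) := by
  obtain ⟨⟨t, ht, hta⟩, hmax⟩ := h
  obtain rfl := hta.eq_best
  have hcl : max p (min s q) ∈ Icc p q := ⟨le_max_left _ _, max_le hpq (min_le_right _ _)⟩
  have h1 : M.tang (max p (min s q)) s ≤ M.tang t s := hmax _ ⟨_, hcl, M.best_spec _⟩
  congr 1
  rcases le_total s p with hp | hp
  · rw [max_eq_left ((min_le_left _ _).trans hp)] at h1 ⊢
    by_contra hne
    exact h1.not_gt (M.tang_lt_of_lt_of_ge (ht.1.lt_of_ne' hne) hp)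
  rcases le_total s q with hq | hq
  · rw [min_eq_left hq, max_eq_right hp] at h1 ⊢
    by_contra hne
    exact h1.not_gt (M.tang_lt hne)
  · rw [min_eq_right hq, max_eq_right hpq] at h1 ⊢
    by_contra hne
    exact h1.not_gt (M.tang_lt_of_lt_of_le (ht.2.lt_of_ne hne) hq)

theorem isBestIn_clamp {p q : ℝ} (hpq : p ≤ q) (s : ℝ) :
    M.IsBestIn (M.firstBestActions (Icc p q)) s (M.best (max p (min s q))) := by
  refine ⟨⟨_, ⟨le_max_left _ _, max_le hpq (min_le_right _ _)⟩, M.best_spec _⟩, ?_⟩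
  rintro a ⟨t, ht, hta⟩
  obtain rfl := hta.eq_best
  exact M.tang_le_clamp ht s

end DelegationModel

/-! ### The payoff as a linear functional of the indirect utility -/

namespace DelegationModel

variable (M : DelegationModel)

theorem integral_F (hlt : M.lo < M.hi) (φ : ℝ → ℝ) :
    ∫ s, φ s ∂M.F = ∫ s in M.lo..M.hi, M.f s * φ s := by
  have hm : AEMeasurable M.f (volume.restrict (Icc M.lo M.hi)) :=
    M.f_continuousOn.aemeasurable measurableSet_Icc
  rw [M.F_eq, integral_withDensity_eq_integral_toReal_smul₀ hm.ennreal_ofReal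
    (Eventually.of_forall fun _ => ENNReal.ofReal_lt_top), intervalIntegral.integral_of_le hlt.le,
    integral_Icc_eq_integral_Ioc]
  refine setIntegral_congr_fun measurableSet_Ioc fun s hs => ?_
  simp only [smul_eq_mul]
  rw [ENNReal.toReal_ofReal (M.f_nonneg s ⟨hs.1.le, hs.2⟩)]

theorem intervalIntegrable_f (hlt : M.lo < M.hi) : IntervalIntegrable M.f volume M.lo M.hi :=
  ContinuousOn.intervalIntegrable (by rw [uIcc_of_le hlt.le]; exact M.f_continuousOn)

/-- The distribution function of the type. -/
noncomputable def cdf (s : ℝ) : ℝ := ∫ x in M.lo..s, M.f x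

theorem cdf_lo : M.cdf M.lo = 0 := intervalIntegral.integral_same

theorem cdf_hi (hlt : M.lo < M.hi) : M.cdf M.hi = 1 := by
  have := M.F_isProbabilityMeasure
  have h := M.integral_F hlt (fun _ => 1)
  simp only [mul_one, integral_const, probReal_univ, smul_eq_mul] at h
  exact h.symm

theorem continuousOn_cdf (hlt : M.lo < M.hi) : ContinuousOn M.cdf (Icc M.lo M.hi) := by
  have := intervalIntegral.continuousOn_primitive_interval' (M.intervalIntegrable_f hlt)
    left_mem_uIcc
  rwa [uIcc_of_le hlt.le] at this

theorem hasDerivAt_cdf {s : ℝ} (hs : s ∈ Ioo M.lo M.hi) : HasDerivAt M.cdf (M.f s) s := by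
  have hlt : M.lo < M.hi := hs.1.trans hs.2
  refine intervalIntegral.integral_hasDerivAt_right ?_ ?_ ?_
  · exact (M.intervalIntegrable_f hlt).mono_set (by
      rw [uIcc_of_le hs.1.le, uIcc_of_le hlt.le]; exact Icc_subset_Icc_right hs.2.le)
  · exact (M.f_continuousOn.mono Ioo_subset_Icc_self).stronglyMeasurableAtFilter isOpen_Ioo s hs
  · exact (M.f_continuousOn s (Ioo_subset_Icc_self hs)).continuousAt (Icc_mem_nhds hs.1 hs.2)

/-- The principal's weight on the slope of the agent's indirect utility: the `μ`-mass of `[s, hi]`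
for `s ∈ (lo, hi]`. -/
noncomputable def tail (s : ℝ) : ℝ := (M.g s - M.κ * s) * M.f s + M.κ * (1 - M.cdf s)

theorem continuousOn_tail (hlt : M.lo < M.hi) : ContinuousOn M.tail (Icc M.lo M.hi) :=
  ((M.g_continuousOn.sub (continuousOn_const.mul continuousOn_id)).mul M.f_continuousOn).add
    (continuousOn_const.mul (continuousOn_const.sub (M.continuousOn_cdf hlt)))

theorem hasDerivAt_tail {s : ℝ} (hs : s ∈ Ioo M.lo M.hi) : HasDerivAt M.tail (-M.nu s) s := by
  have hn : Ioo M.lo M.hi ∈ nhds s := isOpen_Ioo.mem_nhds hs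
  have hg := (M.g_differentiableOn.differentiableAt hn).hasDerivAt
  have hf := (M.f_differentiableOn.differentiableAt hn).hasDerivAt
  have h := ((hg.sub ((hasDerivAt_id s).const_mul M.κ)).mul hf).add
    (((M.hasDerivAt_cdf hs).const_sub 1).const_mul M.κ)
  refine HasDerivAt.congr_deriv (f := M.tail) h ?_
  rw [nu, if_neg hs.2.ne, if_neg hs.1.ne']
  simp
  ring

theorem nu_hi (hlt : M.lo < M.hi) : M.nu M.hi = M.tail M.hi := by
  simp [nu, tail, M.cdf_hi hlt]

theorem nu_lo (hlt : M.lo < M.hi) : M.nu M.lo = M.κ - M.tail M.lo := by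
  simp only [nu, tail, M.cdf_lo, if_neg hlt.ne, if_true]; ring

/-- The payoff of a mechanism in terms of the agent's indirect utility `V` and expected action
`α`. -/
theorem payoff_eq (hlt : M.lo < M.hi) {m : ℝ → ProbabilityMeasure ℝ} {V α : ℝ → ℝ}
    (h : IsSubgradientOn M.lo M.hi V α)
    (hm : ∀ s ∈ Icc M.lo M.hi, M.expUP (m s) s = α s * (M.g s - M.κ * s) + M.κ * V s) (n : ℝ) :
    M.payoff m = (∫ s in M.lo..M.hi, α s * (M.tail s - n)) + (M.κ - n) * V M.lo + n * V M.hi := by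
  -- The constant `n` is free since `∫ α = V hi - V lo`; it shifts boundary weight between the two
  -- end types. Later uses take `0`, `κ` and `tail c`.
  have hp := h.integral_mul_add hlt.le (W := fun s => M.κ * (1 - M.cdf s) - n)
    (W' := fun s => M.κ * (-M.f s))
    ((continuousOn_const.mul (continuousOn_const.sub (M.continuousOn_cdf hlt))).sub
      continuousOn_const)
    (fun s hs => (((M.hasDerivAt_cdf hs).const_sub 1).const_mul M.κ).sub_const n)
    ((M.intervalIntegrable_f hlt).neg.const_mul _)
  have hα := h.intervalIntegrable hlt.le
  have hi1 : IntervalIntegrable (fun s => α s * (M.tail s - n)) volume M.lo M.hi :=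
    hα.mul_continuousOn (by
      rw [uIcc_of_le hlt.le]; exact (M.continuousOn_tail hlt).sub continuousOn_const)
  have hi2 : IntervalIntegrable (fun s => α s * (M.κ * (1 - M.cdf s) - n) + V s * (M.κ * (-M.f s)))
      volume M.lo M.hi := by
    refine (hα.mul_continuousOn ?_).add
      (((M.intervalIntegrable_f hlt).neg.const_mul _).continuousOn_mul ?_)
    · rw [uIcc_of_le hlt.le]
      exact (continuousOn_const.mul (continuousOn_const.sub (M.continuousOn_cdf hlt))).sub
        continuousOn_const
    · rw [uIcc_of_le hlt.le]; exact h.continuousOn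
  have he : M.payoff m = ∫ s in M.lo..M.hi, (α s * (M.tail s - n) -
      (α s * (M.κ * (1 - M.cdf s) - n) + V s * (M.κ * (-M.f s)))) := by
    rw [payoff, M.integral_F hlt]
    refine intervalIntegral.integral_congr fun s hs => ?_
    rw [uIcc_of_le hlt.le] at hs
    simp only [hm s hs, tail]
    ring
  rw [he, intervalIntegral.integral_sub hi1 hi2, hp, M.cdf_hi hlt, M.cdf_lo]
  ring

theorem expUA_eq {p : ProbabilityMeasure ℝ} (ha : Integrable (fun a : ℝ => a) (p : Measure ℝ))
    (hb : Integrable M.b (p : Measure ℝ)) (s : ℝ) :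
    M.expUA p s = (∫ a, a ∂(p : Measure ℝ)) * s + ∫ a, M.b a ∂(p : Measure ℝ) := by
  simp only [expUA, uA]
  rw [integral_add (ha.mul_const s) hb, integral_mul_const]

theorem expUP_eq {p : ProbabilityMeasure ℝ} (ha : Integrable (fun a : ℝ => a) (p : Measure ℝ))
    (hb : Integrable M.b (p : Measure ℝ)) (s : ℝ) :
    M.expUP p s = (∫ a, a ∂(p : Measure ℝ)) * (M.g s - M.κ * s) + M.κ * M.expUA p s := by
  rw [M.expUA_eq ha hb]
  simp only [expUP, uP]
  rw [integral_add (ha.mul_const _) (hb.const_mul _), integral_mul_const, integral_const_mul]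
  ring

theorem expUA_le {p : ProbabilityMeasure ℝ} (ha : Integrable (fun a : ℝ => a) (p : Measure ℝ))
    (hb : Integrable M.b (p : Measure ℝ)) (s : ℝ) : M.expUA p s ≤ M.tang s s := by
  have h := integral_mono (μ := (p : Measure ℝ)) ((ha.mul_const s).add hb)
    (integrable_const (M.tang s s)) (fun a => M.uA_le_best a s)
  simpa [expUA, uA] using h

/-- A lottery's value to the agent is affine in her type, with the mean action as slope, so
incentive compatibility is exactly the subgradient inequality. This is how stochastic mechanisms are
covered. -/
theorem IsMechanism.isSubgradientOn {M : DelegationModel} {m : ℝ → ProbabilityMeasure ℝ}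
    (hm : M.IsMechanism m) (hic : M.IsIncentiveCompatible m) :
    IsSubgradientOn M.lo M.hi (fun s => M.expUA (m s) s)
      (fun s => ∫ a, a ∂(m s : Measure ℝ)) := by
  intro s hs t ht
  have h1 := hic t ht s hs
  have h2 := M.expUA_eq (hm.integrable_action s hs) (hm.integrable_b s hs)
  have h3 := h2 t
  have h4 := h2 s
  simp only
  linarith

/-- The lottery that gives `a` for sure. -/
noncomputable def sure (a : ℝ) : ProbabilityMeasure ℝ := ⟨Measure.dirac a, inferInstance⟩

theorem coe_sure (a : ℝ) : (sure a : Measure ℝ) = Measure.dirac a := rfl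

theorem expUA_sure (a s : ℝ) : M.expUA (sure a) s = M.uA a s := by
  simp [expUA, coe_sure, integral_dirac]

theorem expUP_sure (a s : ℝ) : M.expUP (sure a) s = M.uP a s := by
  simp [expUP, coe_sure, integral_dirac]

theorem expUP_sure_best (t s : ℝ) : M.expUP (sure (M.best t)) s =
    M.best t * (M.g s - M.κ * s) + M.κ * M.tang t s := by
  rw [expUP_sure, tang, uA, uP]; ring

theorem isIncentiveCompatible_sure {τ : ℝ → ℝ} (hτ : ∀ x y, M.tang (τ y) x ≤ M.tang (τ x) x) :
    M.IsIncentiveCompatible fun s => sure (M.best (τ s)) := by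
  intro s _ t _
  rw [expUA_sure, expUA_sure]
  exact hτ s t

theorem isMechanism_sure {τ : ℝ → ℝ} (hτ : ∀ x y, M.tang (τ y) x ≤ M.tang (τ x) x) :
    M.IsMechanism fun s => sure (M.best (τ s)) := by
  have := M.F_isProbabilityMeasure
  have hsub := M.isSubgradientOn_tang hτ M.lo M.hi
  have hF : M.F.restrict (Icc M.lo M.hi) = M.F := by
    rw [M.F_eq, restrict_withDensity measurableSet_Icc, Measure.restrict_restrict measurableSet_Icc,
      inter_self]
  have hV : IntegrableOn (fun s => M.tang (τ s) s) (Icc M.lo M.hi) M.F :=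
    hsub.continuousOn.integrableOn_compact isCompact_Icc
  have hα : IntegrableOn (fun s => M.best (τ s)) (Icc M.lo M.hi) M.F :=
    hsub.monotoneOn.integrableOn_isCompact isCompact_Icc
  refine ⟨fun s _ => ?_, fun s _ => ?_, ?_, ?_⟩
  · exact integrable_dirac (by simp)
  · exact integrable_dirac (by simp)
  · simp only [expUA_sure]
    rwa [← hF]
  · simp only [expUP_sure_best]
    rw [← hF]
    exact (hα.mul_continuousOn (M.g_continuousOn.sub (continuousOn_const.mul continuousOn_id))
      isCompact_Icc).add (hV.const_mul _)

theorem payoff_sure (hlt : M.lo < M.hi) {τ : ℝ → ℝ}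
    (hτ : ∀ x y, M.tang (τ y) x ≤ M.tang (τ x) x) (n : ℝ) :
    M.payoff (fun s => sure (M.best (τ s))) =
      (∫ s in M.lo..M.hi, M.best (τ s) * (M.tail s - n)) + (M.κ - n) * M.tang (τ M.lo) M.lo
        + n * M.tang (τ M.hi) M.hi :=
  M.payoff_eq hlt (M.isSubgradientOn_tang hτ _ _) (fun s _ => M.expUP_sure_best _ s) n

end DelegationModel

/-! ### Conditions on `nu` rewritten in terms of `tail` -/

namespace DelegationModel

variable (M : DelegationModel)

theorem intervalIntegrable_nu (hlt : M.lo < M.hi) (hν : Integrable M.nu M.lam) :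
    IntervalIntegrable M.nu volume M.lo M.hi := by
  rw [intervalIntegrable_iff_integrableOn_Icc_of_le hlt.le]
  exact hν.left_of_add_measure

theorem isSubgradientOn_affine (x y c : ℝ) : IsSubgradientOn x y (fun s => s - c) (fun _ => 1) := by
  intro s _ t _
  simp

theorem integral_sub_mul_nu (hlt : M.lo < M.hi) (hν : Integrable M.nu M.lam) {x y : ℝ}
    (hx : M.lo ≤ x) (hxy : x ≤ y) (hy : y ≤ M.hi) (c : ℝ) :
    ∫ s in x..y, (s - c) * M.nu s =
      (∫ s in x..y, M.tail s) - ((y - c) * M.tail y - (x - c) * M.tail x) := by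
  have hN := (M.continuousOn_tail hlt).mono (Icc_subset_Icc hx hy)
  have hνi : IntervalIntegrable M.nu volume x y :=
    (M.intervalIntegrable_nu hlt hν).mono_set (by
      rw [uIcc_of_le hxy, uIcc_of_le hlt.le]; exact Icc_subset_Icc hx hy)
  have hNi : IntervalIntegrable M.tail volume x y :=
    ContinuousOn.intervalIntegrable (by rwa [uIcc_of_le hxy])
  have hcν : IntervalIntegrable (fun s => (s - c) * M.nu s) volume x y :=
    hνi.continuousOn_mul (continuous_id.sub continuous_const).continuousOn
  have h := (isSubgradientOn_affine x y c).integral_mul_add hxy hN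
    (fun s hs => M.hasDerivAt_tail ⟨hx.trans_lt hs.1, hs.2.trans_le hy⟩) hνi.neg
  have e : ∀ s, (1 : ℝ) * M.tail s + (s - c) * -M.nu s = M.tail s - (s - c) * M.nu s := by
    intro s; ring
  simp_rw [e] at h
  rw [intervalIntegral.integral_sub hNi hcν] at h
  linarith

/-- Conditioning divides by `λ(B)`, which is positive because `B` contains an atom and finite
because `S` is bounded; the signs in the claim are unaffected. -/
theorem exists_setIntegral_cond_lam {B : Set ℝ} (hB : M.lo ∈ B ∨ M.hi ∈ B)
    (hBm : MeasurableSet B) :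
    ∃ c : ℝ, 0 < c ∧ ∀ (E : Set ℝ) (φ : ℝ → ℝ), MeasurableSet E → E ⊆ B →
      ∫ x in E, φ x ∂(ProbabilityTheory.cond M.lam B) = c * ∫ x in E, φ x ∂M.lam := by
  have h0 : M.lam B ≠ 0 := by
    simp only [lam, Measure.coe_add, Pi.add_apply, Measure.dirac_apply' _ hBm]
    rcases hB with h | h <;> simp [h]
  have htop : M.lam B ≠ ⊤ := by
    have : IsFiniteMeasure (volume.restrict M.S) :=
      ⟨by rw [Measure.restrict_apply_univ]; exact measure_Icc_lt_top⟩
    have : IsFiniteMeasure M.lam := by unfold lam; infer_instance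
    exact measure_ne_top _ _
  refine ⟨((M.lam B)⁻¹).toReal, ENNReal.toReal_pos (ENNReal.inv_ne_zero.2 htop)
    (ENNReal.inv_ne_top.2 h0), fun E φ hE hEB => ?_⟩
  rw [ProbabilityTheory.cond, Measure.restrict_smul, Measure.restrict_restrict hE,
    inter_eq_left.2 hEB, integral_smul_measure, smul_eq_mul]

/-- Integration by parts leaves the boundary term `-(hi - s) * tail hi`, which the atom at `hi`
cancels. The atom at `lo` is excluded since `lo < s`. -/
theorem setIntegral_Icc_hi (hlt : M.lo < M.hi) (hν : Integrable M.nu M.lam) {s : ℝ}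
    (hs : M.lo < s) (hs' : s ≤ M.hi) :
    ∫ x in Icc s M.hi, (x - s) * M.nu x ∂M.lam = ∫ x in s..M.hi, M.tail x := by
  have hi : IntervalIntegrable (fun x => (x - s) * M.nu x) volume s M.hi :=
    ((M.intervalIntegrable_nu hlt hν).mono_set (by
      rw [uIcc_of_le hs', uIcc_of_le hlt.le]; exact Icc_subset_Icc_left hs.le)).continuousOn_mul
      (continuous_id.sub continuous_const).continuousOn
  have hr : M.lam.restrict (Icc s M.hi) = volume.restrict (Icc s M.hi) + Measure.dirac M.hi := by
    classical
    rw [lam, Measure.restrict_add, Measure.restrict_add, S, Measure.restrict_restrict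
      measurableSet_Icc, inter_eq_left.2 (Icc_subset_Icc_left hs.le),
      restrict_dirac' measurableSet_Icc, restrict_dirac' measurableSet_Icc,
      if_neg (fun h => hs.not_ge h.1), if_pos ⟨hs', le_rfl⟩, zero_add]
  rw [hr, integral_add_measure ((intervalIntegrable_iff_integrableOn_Icc_of_le hs').1 hi)
    (integrable_dirac enorm_lt_top), integral_dirac, integral_Icc_eq_integral_Ioc,
    ← intervalIntegral.integral_of_le hs', M.integral_sub_mul_nu hlt hν hs.le hs' le_rfl,
    M.nu_hi hlt]
  ring

theorem setIntegral_Icc_lo (hlt : M.lo < M.hi) (hν : Integrable M.nu M.lam) {s : ℝ}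
    (hs : M.lo ≤ s) (hs' : s < M.hi) :
    ∫ x in Icc M.lo s, (s - x) * M.nu x ∂M.lam = ∫ x in M.lo..s, (M.κ - M.tail x) := by
  have hsub : uIcc M.lo s ⊆ uIcc M.lo M.hi := by
    rw [uIcc_of_le hs, uIcc_of_le hlt.le]; exact Icc_subset_Icc_right hs'.le
  have hi : IntervalIntegrable (fun x => (x - s) * M.nu x) volume M.lo s :=
    ((M.intervalIntegrable_nu hlt hν).mono_set hsub).continuousOn_mul
      (continuous_id.sub continuous_const).continuousOn
  have hNi : IntervalIntegrable M.tail volume M.lo s := by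
    refine ContinuousOn.intervalIntegrable ((M.continuousOn_tail hlt).mono ?_)
    rwa [← uIcc_of_le hlt.le]
  have hr : M.lam.restrict (Icc M.lo s) = volume.restrict (Icc M.lo s) + Measure.dirac M.lo := by
    classical
    rw [lam, Measure.restrict_add, Measure.restrict_add, S, Measure.restrict_restrict
      measurableSet_Icc, inter_eq_left.2 (Icc_subset_Icc_right hs'.le),
      restrict_dirac' measurableSet_Icc, restrict_dirac' measurableSet_Icc,
      if_pos ⟨le_rfl, hs⟩, if_neg (fun h => hs'.not_ge h.2), add_zero]
  have e : ∀ x, (s - x) * M.nu x = -((x - s) * M.nu x) := fun x => by ring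
  simp_rw [e]
  rw [integral_neg, hr, integral_add_measure ((intervalIntegrable_iff_integrableOn_Icc_of_le hs).1
    hi) (integrable_dirac enorm_lt_top), integral_dirac, integral_Icc_eq_integral_Ioc,
    ← intervalIntegral.integral_of_le hs, M.integral_sub_mul_nu hlt hν le_rfl hs hs'.le,
    M.nu_lo hlt, intervalIntegral.integral_sub (by simp) hNi]
  simp
  ring

/-- The optimality conditions in terms of `tail`. -/
def TailConditions (s₁ s₂ : ℝ) : Prop :=
  (∀ s ∈ Icc s₁ s₂, 0 ≤ M.nu s) ∧
    ((∀ s ∈ Icc s₂ M.hi, ∫ x in s..M.hi, M.tail x ≤ 0) ∧ ∫ x in s₂..M.hi, M.tail x = 0) ∧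
    ((∀ s ∈ Icc M.lo s₁, ∫ x in M.lo..s, (M.κ - M.tail x) ≤ 0) ∧
      ∫ x in M.lo..s₁, (M.κ - M.tail x) = 0)

theorem tailConditions_iff (hν : Integrable M.nu M.lam) {s₁ s₂ : ℝ} (hs₁ : s₁ ∈ M.S)
    (hs₂ : s₂ ∈ M.S) (h12 : s₁ < s₂) :
    M.TailConditions s₁ s₂ ↔
      (∀ s ∈ Set.Icc s₁ s₂, 0 ≤ M.nu s) ∧
      ((∀ s ∈ Set.Icc s₂ M.hi,
          ∫ x in Set.Icc s M.hi, (x - s) * M.nu x ∂(ProbabilityTheory.cond M.lam (Set.Ici s₂)) ≤ 0) ∧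
        ∫ x in Set.Icc s₂ M.hi,
          (x - s₂) * M.nu x ∂(ProbabilityTheory.cond M.lam (Set.Ici s₂)) = 0) ∧
      ((∀ s ∈ Set.Icc M.lo s₁,
          ∫ x in Set.Icc M.lo s, (s - x) * M.nu x ∂(ProbabilityTheory.cond M.lam (Set.Iic s₁)) ≤ 0) ∧
        ∫ x in Set.Icc M.lo s₁,
          (s₁ - x) * M.nu x ∂(ProbabilityTheory.cond M.lam (Set.Iic s₁)) = 0) := by
  have hlt : M.lo < M.hi := hs₁.1.trans_lt (h12.trans_le hs₂.2)
  obtain ⟨c, hc, hcE⟩ := M.exists_setIntegral_cond_lam (B := Ici s₂) (Or.inr hs₂.2) measurableSet_Ici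
  obtain ⟨d, hd, hdE⟩ := M.exists_setIntegral_cond_lam (B := Iic s₁) (Or.inl hs₁.1) measurableSet_Iic
  have hR : ∀ s ∈ Icc s₂ M.hi, ∫ x in Icc s M.hi, (x - s) * M.nu x
      ∂(ProbabilityTheory.cond M.lam (Ici s₂)) = c * ∫ x in s..M.hi, M.tail x := fun s hs => by
    rw [hcE _ _ measurableSet_Icc fun x hx => hs.1.trans hx.1,
      M.setIntegral_Icc_hi hlt hν (hs₁.1.trans_lt (h12.trans_le hs.1)) hs.2]
  have hL : ∀ s ∈ Icc M.lo s₁, ∫ x in Icc M.lo s, (s - x) * M.nu x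
      ∂(ProbabilityTheory.cond M.lam (Iic s₁)) = d * ∫ x in M.lo..s, (M.κ - M.tail x) :=
    fun s hs => by
      rw [hdE _ _ measurableSet_Icc fun x hx => hx.2.trans hs.2,
        M.setIntegral_Icc_lo hlt hν hs.1 (hs.2.trans_lt (h12.trans_le hs₂.2))]
  have hR' := hR s₂ ⟨le_rfl, hs₂.2⟩
  have hL' := hL s₁ ⟨hs₁.1, le_rfl⟩
  rw [TailConditions, hR', hL', mul_eq_zero_iff_left hc.ne', mul_eq_zero_iff_left hd.ne']
  refine and_congr_right fun _ => and_congr (and_congr_left fun _ => forall₂_congr fun s hs => ?_)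
    (and_congr_left fun _ => forall₂_congr fun s hs => ?_)
  · rw [hR s hs, mul_nonpos_iff_pos_imp_nonpos]; constructor
    · exact fun h => ⟨fun _ => h, fun _ => hc.le⟩
    · exact fun h => h.1 hc
  · rw [hL s hs, mul_nonpos_iff_pos_imp_nonpos]; constructor
    · exact fun h => ⟨fun _ => h, fun _ => hd.le⟩
    · exact fun h => h.1 hd

end DelegationModel

/-! ### Sufficiency -/

namespace DelegationModel

variable (M : DelegationModel)

theorem intervalIntegrable_tail (hlt : M.lo < M.hi) {x y : ℝ} (hx : x ∈ Icc M.lo M.hi)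
    (hy : y ∈ Icc M.lo M.hi) : IntervalIntegrable M.tail volume x y :=
  ContinuousOn.intervalIntegrable
    ((M.continuousOn_tail hlt).mono ((uIcc_subset_Icc hx hy)))

/-- Integrating by parts only on `[s₁, s₂]` puts weight `nu` on `V` there and keeps `α` outside. On
the left, `κ * V lo` is absorbed by replacing `tail` with `tail - κ`. -/
theorem integral_mul_tail_eq_add (hlt : M.lo < M.hi) (hν : Integrable M.nu M.lam) {s₁ s₂ : ℝ}
    (h1 : M.lo ≤ s₁) (h12 : s₁ ≤ s₂) (h2 : s₂ ≤ M.hi) {V α : ℝ → ℝ}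
    (h : IsSubgradientOn M.lo M.hi V α) :
    (∫ s in M.lo..M.hi, α s * M.tail s) + M.κ * V M.lo =
      (∫ s in M.lo..s₁, α s * (M.tail s - M.κ)) + V s₁ * (M.κ - M.tail s₁) +
        (∫ s in s₁..s₂, V s * M.nu s) + V s₂ * M.tail s₂ + ∫ s in s₂..M.hi, α s * M.tail s := by
  have i1 : s₁ ∈ Icc M.lo M.hi := ⟨h1, h12.trans h2⟩
  have i2 : s₂ ∈ Icc M.lo M.hi := ⟨h1.trans h12, h2⟩
  have il : M.lo ∈ Icc M.lo M.hi := ⟨le_rfl, hlt.le⟩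
  have ih : M.hi ∈ Icc M.lo M.hi := ⟨hlt.le, le_rfl⟩
  have hαN : IntervalIntegrable (fun s => α s * M.tail s) volume M.lo M.hi :=
    (h.intervalIntegrable hlt.le).mul_continuousOn (by
      rw [uIcc_of_le hlt.le]; exact M.continuousOn_tail hlt)
  have hαN' : ∀ {x y}, x ∈ Icc M.lo M.hi → y ∈ Icc M.lo M.hi →
      IntervalIntegrable (fun s => α s * M.tail s) volume x y := fun hx hy =>
    hαN.mono_set (by rw [uIcc_of_le hlt.le]; exact uIcc_subset_Icc hx hy)
  have hleft : ∫ s in M.lo..s₁, α s * (M.tail s - M.κ) =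
      (∫ s in M.lo..s₁, α s * M.tail s) - M.κ * (V s₁ - V M.lo) := by
    have hs := h.mono le_rfl i1.2
    simp_rw [mul_sub]
    rw [intervalIntegral.integral_sub (hαN' il i1) ((hs.intervalIntegrable h1).mul_const _),
      intervalIntegral.integral_mul_const, hs.integral_eq_sub h1]
    ring
  have hmid : ∫ s in s₁..s₂, α s * M.tail s =
      V s₂ * M.tail s₂ - V s₁ * M.tail s₁ + ∫ s in s₁..s₂, V s * M.nu s := by
    have hs := h.mono h1 h2
    have hνi : IntervalIntegrable M.nu volume s₁ s₂ :=
      (M.intervalIntegrable_nu hlt hν).mono_set (by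
        rw [uIcc_of_le hlt.le]; exact uIcc_subset_Icc i1 i2)
    have hVν : IntervalIntegrable (fun s => V s * -M.nu s) volume s₁ s₂ :=
      hνi.neg.continuousOn_mul (by rw [uIcc_of_le h12]; exact hs.continuousOn)
    have hp := hs.integral_mul_add h12
      ((M.continuousOn_tail hlt).mono (Icc_subset_Icc h1 h2))
      (fun s hs => M.hasDerivAt_tail ⟨h1.trans_lt hs.1, hs.2.trans_le h2⟩) hνi.neg
    rw [intervalIntegral.integral_add (hαN' i1 i2) hVν] at hp
    simp only [mul_neg, intervalIntegral.integral_neg] at hp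
    linarith
  rw [← intervalIntegral.integral_add_adjacent_intervals (hαN' il i1) (hαN' i1 ih),
    ← intervalIntegral.integral_add_adjacent_intervals (hαN' i1 i2) (hαN' i2 ih), hleft, hmid]
  ring

/-- At `s₂ = hi` this is the sign of the atom. Otherwise zero total and nonpositive upper tails make
the integrals starting at `s₂` nonnegative, hence also the continuous integrand at `s₂`. -/
theorem TailConditions.tail_nonneg {M : DelegationModel} {s₁ s₂ : ℝ} (hlt : M.lo < M.hi)
    (h1 : M.lo ≤ s₁) (h12 : s₁ < s₂) (h2 : s₂ ≤ M.hi) (h : M.TailConditions s₁ s₂) :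
    0 ≤ M.tail s₂ := by
  rcases h2.eq_or_lt with rfl | h2'
  · rw [← M.nu_hi hlt]
    exact h.1 _ ⟨h12.le, le_rfl⟩
  · refine nonneg_left_of_integral_nonneg h2'
      ((M.continuousOn_tail hlt).mono (Icc_subset_Icc_left (h1.trans h12.le))) fun t ht => ?_
    have i2 : s₂ ∈ Icc M.lo M.hi := ⟨h1.trans h12.le, h2⟩
    have it : t ∈ Icc M.lo M.hi := ⟨i2.1.trans ht.1, ht.2⟩
    have := intervalIntegral.integral_add_adjacent_intervals
      (M.intervalIntegrable_tail hlt i2 it) (M.intervalIntegrable_tail hlt it ⟨hlt.le, le_rfl⟩)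
    have h3 := h.2.1.1 t ht
    have h4 := h.2.1.2
    linarith

theorem TailConditions.tail_le {M : DelegationModel} {s₁ s₂ : ℝ} (hlt : M.lo < M.hi)
    (h1 : M.lo ≤ s₁) (h12 : s₁ < s₂) (h2 : s₂ ≤ M.hi) (h : M.TailConditions s₁ s₂) :
    0 ≤ M.κ - M.tail s₁ := by
  rcases h1.eq_or_lt with rfl | h1'
  · rw [← M.nu_lo hlt]
    exact h.1 _ ⟨le_rfl, h12.le⟩
  · refine nonneg_right_of_integral_nonneg (N := fun s => M.κ - M.tail s) h1'
      (continuousOn_const.sub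
        ((M.continuousOn_tail hlt).mono (Icc_subset_Icc_right (h12.le.trans h2)))) fun t ht => ?_
    have i1 : s₁ ∈ Icc M.lo M.hi := ⟨h1, h12.le.trans h2⟩
    have it : t ∈ Icc M.lo M.hi := ⟨ht.1, ht.2.trans i1.2⟩
    have hi : ∀ {x y}, x ∈ Icc M.lo M.hi → y ∈ Icc M.lo M.hi →
        IntervalIntegrable (fun s => M.κ - M.tail s) volume x y := fun hx hy =>
      (by simp : IntervalIntegrable (fun _ => M.κ) volume _ _).sub
        (M.intervalIntegrable_tail hlt hx hy)
    have := intervalIntegral.integral_add_adjacent_intervals (hi ⟨le_rfl, hlt.le⟩ it) (hi it i1)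
    have h3 := h.2.2.1 t ht
    have h4 := h.2.2.2
    linarith

theorem tang_clamp_le {p q : ℝ} (hpq : p ≤ q) (x y : ℝ) :
    M.tang (max p (min y q)) x ≤ M.tang (max p (min x q)) x :=
  M.tang_le_clamp ⟨le_max_left _ _, max_le hpq (min_le_right _ _)⟩ x

/-- The five terms of `integral_mul_tail_eq_add` are compared one by one. The outer integrals vanish
for delegation, whose action is constant on each side of the interval. -/
theorem TailConditions.payoff_le {M : DelegationModel} (hν : Integrable M.nu M.lam) {s₁ s₂ : ℝ}
    (hlt : M.lo < M.hi) (h1 : M.lo ≤ s₁) (h12 : s₁ < s₂) (h2 : s₂ ≤ M.hi)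
    (h : M.TailConditions s₁ s₂) {m : ℝ → ProbabilityMeasure ℝ} (hm : M.IsMechanism m)
    (hic : M.IsIncentiveCompatible m) :
    M.payoff m ≤ M.payoff fun s => sure (M.best (max s₁ (min s s₂))) := by
  have i1 : s₁ ∈ Icc M.lo M.hi := ⟨h1, h12.le.trans h2⟩
  have i2 : s₂ ∈ Icc M.lo M.hi := ⟨h1.trans h12.le, h2⟩
  have hτ := M.tang_clamp_le h12.le
  have hsub := hm.isSubgradientOn hic
  have hsub0 := M.isSubgradientOn_tang hτ M.lo M.hi
  have hp := M.payoff_eq hlt hsub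
    (fun s hs => M.expUP_eq (hm.integrable_action s hs) (hm.integrable_b s hs) s) 0
  have hp0 := M.payoff_sure hlt hτ 0
  have hle : ∀ s ∈ Icc s₁ s₂, M.expUA (m s) s ≤ M.tang (max s₁ (min s s₂)) s := fun s hs => by
    rw [min_eq_left hs.2, max_eq_right hs.1]
    have hsI : s ∈ Icc M.lo M.hi := ⟨h1.trans hs.1, hs.2.trans h2⟩
    exact M.expUA_le (hm.integrable_action s hsI) (hm.integrable_b s hsI) s
  have hdec := M.integral_mul_tail_eq_add hlt hν h1 h12.le h2 hsub
  have hdec0 := M.integral_mul_tail_eq_add hlt hν h1 h12.le h2 hsub0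
  simp only [sub_zero, zero_mul, add_zero] at hp hp0
  rw [hp, hp0, hdec, hdec0]
  have hN := M.continuousOn_tail hlt
  have hint : ∀ {x y}, x ∈ Icc M.lo M.hi → y ∈ Icc M.lo M.hi →
      IntervalIntegrable (fun s => M.κ - M.tail s) volume x y := fun hx hy =>
    (by simp : IntervalIntegrable (fun _ => M.κ) volume _ _).sub
      (M.intervalIntegrable_tail hlt hx hy)
  have hflip : ∀ x y, ∫ s in x..y, (M.tail s - M.κ) = -∫ s in x..y, (M.κ - M.tail s) := fun x y => by
    rw [← intervalIntegral.integral_neg]; congr 1; ext s; ring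
  have e1 : ∫ s in M.lo..s₁, (∫ a, a ∂(m s : Measure ℝ)) * (M.tail s - M.κ) ≤ 0 := by
    refine integral_monotoneOn_mul_nonpos h1 (hsub.mono le_rfl i1.2).monotoneOn
      ((hN.mono (Icc_subset_Icc_right i1.2)).sub continuousOn_const) (fun t ht => ?_) ?_
    · have it : t ∈ Icc M.lo M.hi := ⟨ht.1, ht.2.trans i1.2⟩
      have := intervalIntegral.integral_add_adjacent_intervals (hint ⟨le_rfl, hlt.le⟩ it)
        (hint it i1)
      have h3 := h.2.2.1 t ht
      have h4 := h.2.2.2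
      rw [hflip]
      linarith
    · rw [hflip, h.2.2.2, neg_zero]
  have e5 : ∫ s in s₂..M.hi, (∫ a, a ∂(m s : Measure ℝ)) * M.tail s ≤ 0 :=
    integral_monotoneOn_mul_nonpos h2 (hsub.mono i2.1 le_rfl).monotoneOn
      (hN.mono (Icc_subset_Icc_left i2.1)) h.2.1.1 h.2.1.2
  have e1' : ∫ s in M.lo..s₁, M.best (max s₁ (min s s₂)) * (M.tail s - M.κ) = 0 := by
    have : ∫ s in M.lo..s₁, M.best (max s₁ (min s s₂)) * (M.tail s - M.κ) =
        ∫ s in M.lo..s₁, M.best s₁ * (M.tail s - M.κ) := by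
      refine intervalIntegral.integral_congr fun s hs => ?_
      rw [uIcc_of_le h1] at hs
      simp only [max_eq_left ((min_le_left s s₂).trans hs.2)]
    rw [this, intervalIntegral.integral_const_mul, hflip, h.2.2.2]
    simp
  have e5' : ∫ s in s₂..M.hi, M.best (max s₁ (min s s₂)) * M.tail s = 0 := by
    have : ∫ s in s₂..M.hi, M.best (max s₁ (min s s₂)) * M.tail s =
        ∫ s in s₂..M.hi, M.best s₂ * M.tail s := by
      refine intervalIntegral.integral_congr fun s hs => ?_
      rw [uIcc_of_le h2] at hs
      simp only [min_eq_right hs.1, max_eq_right h12.le]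
    rw [this, intervalIntegral.integral_const_mul, h.2.1.2, mul_zero]
  have e2 := mul_le_mul_of_nonneg_right (hle s₁ ⟨le_rfl, h12.le⟩) (h.tail_le hlt h1 h12 h2)
  have e4 := mul_le_mul_of_nonneg_right (hle s₂ ⟨h12.le, le_rfl⟩) (h.tail_nonneg hlt h1 h12 h2)
  have hνi : IntervalIntegrable M.nu volume s₁ s₂ :=
    (M.intervalIntegrable_nu hlt hν).mono_set (by
      rw [uIcc_of_le hlt.le]; exact uIcc_subset_Icc i1 i2)
  have e3 := intervalIntegral.integral_mono_on h12.le
    (hνi.continuousOn_mul (by rw [uIcc_of_le h12.le]; exact (hsub.mono h1 h2).continuousOn))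
    (hνi.continuousOn_mul (by rw [uIcc_of_le h12.le]; exact (hsub0.mono h1 h2).continuousOn))
    (fun s hs => mul_le_mul_of_nonneg_right (hle s hs) (h.1 s hs))
  linarith

theorem TailConditions.delegatingIsOptimal {M : DelegationModel} (hν : Integrable M.nu M.lam)
    {s₁ s₂ : ℝ} (hlt : M.lo < M.hi) (h1 : M.lo ≤ s₁) (h12 : s₁ < s₂) (h2 : s₂ ≤ M.hi)
    (h : M.TailConditions s₁ s₂) : M.DelegatingIsOptimal (Icc s₁ s₂) := by
  have hτ := M.tang_clamp_le h12.le
  refine ⟨fun s => sure (M.best (max s₁ (min s s₂))),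
    ⟨⟨M.isMechanism_sure hτ, M.isIncentiveCompatible_sure hτ⟩,
      fun m' hm' hic' => h.payoff_le hν hlt h1 h12 h2 hm' hic'⟩, fun s hs => ?_, fun s _ => ?_⟩
  · refine ⟨M.best s, M.best_spec s, ?_⟩
    beta_reduce
    rw [min_eq_left hs.2, max_eq_right hs.1, coe_sure]
  · exact ⟨_, M.isBestIn_clamp h12.le s, rfl⟩

end DelegationModel

/-! ### Limits of trimming inequalities -/

section

variable {a y : ℝ} {β N : ℝ → ℝ}

theorem intervalIntegrable_sub_mul (hβ : StrictMono β) (hN : ContinuousOn N (Icc a y)) {s t : ℝ}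
    (hs : a ≤ s) (hst : s ≤ t) (ht : t ≤ y) (c : ℝ) :
    IntervalIntegrable (fun x => (β x - c) * N x) volume s t :=
  (hβ.monotone.intervalIntegrable.sub (by simp)).mul_continuousOn (by
    rw [uIcc_of_le hst]; exact hN.mono (Icc_subset_Icc hs ht))

/-- If the integrals of `β - β t` against the restriction of `N` to `[t, y]`, extended beyond `y`
by a mass `Φ`, are nonnegative for all `t < y`, then `Φ` is nonnegative. -/
theorem nonneg_of_integral_sub_mul_add (hay : a < y) (hβ : StrictMono β)
    (hN : ContinuousOn N (Icc a y)) {Φ : ℝ}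
    (h : ∀ t ∈ Ioo a y, 0 ≤ (∫ s in t..y, (β s - β t) * N s) + (β y - β t) * Φ) : 0 ≤ Φ := by
  obtain ⟨C, hC⟩ := isCompact_Icc.exists_bound_of_continuousOn hN
  -- The integral is at most `(β y - β t) * C * (y - t)`, so dividing by `β y - β t` leaves an error
  -- vanishing as `t → y`.
  have key : ∀ t ∈ Ioo a y, 0 ≤ C * (y - t) + Φ := by
    intro t ht
    have hpos : 0 < β y - β t := sub_pos.2 (hβ ht.2)
    have hb : ‖∫ s in t..y, (β s - β t) * N s‖ ≤ (β y - β t) * C * |y - t| := by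
      refine intervalIntegral.norm_integral_le_of_norm_le_const fun s hs => ?_
      rw [uIoc_of_le ht.2.le] at hs
      rw [norm_mul, Real.norm_of_nonneg (sub_nonneg.2 (hβ.monotone hs.1.le))]
      exact mul_le_mul (sub_le_sub_right (hβ.monotone hs.2) _)
        (hC s ⟨ht.1.le.trans hs.1.le, hs.2⟩) (norm_nonneg _) hpos.le
    rw [abs_of_pos (sub_pos.2 ht.2)] at hb
    have h1 := h t ht
    have h2 := (le_abs_self _).trans hb
    have h3 : 0 ≤ (β y - β t) * (C * (y - t) + Φ) := by linarith
    exact nonneg_of_mul_nonneg_right h3 hpos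
  have hlim : Tendsto (fun t => C * (y - t) + Φ) (nhdsWithin y (Ioo a y)) (nhds (C * (y - y) + Φ)) :=
    (Continuous.tendsto (by fun_prop) y).mono_left nhdsWithin_le_nhds
  have := right_nhdsWithin_Ioo_neBot hay
  have := ge_of_tendsto hlim (eventually_mem_nhdsWithin.mono key)
  simpa using this

theorem nonneg_of_integral_sub_mul (hay : a < y) (hβ : StrictMono β)
    (hN : ContinuousOn N (Icc a y))
    (h : ∀ t ∈ Ioo a y, 0 ≤ ∫ s in t..y, (β s - β t) * N s) : 0 ≤ N y := by
  by_contra! hneg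
  have hc : ContinuousWithinAt N (Icc a y) y := hN y (right_mem_Icc.2 hay.le)
  have hev : ∀ᶠ s in nhdsWithin y (Icc a y), N s < 0 := hc.eventually_lt_const hneg
  rw [nhdsWithin_Icc_eq_nhdsLE hay] at hev
  obtain ⟨u, hu, hsub⟩ := (mem_nhdsLE_iff_exists_Icc_subset).1 hev
  obtain ⟨t, ht, hty⟩ := exists_between (max_lt hu hay)
  have hta : a < t := (le_max_right _ _).trans_lt ht
  have h1 := h t ⟨hta, hty⟩
  have h2 := intervalIntegral.intervalIntegral_pos_of_pos_on
    (intervalIntegrable_sub_mul hβ hN hta.le hty.le le_rfl (β t)).neg (fun s hs => by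
      have h3 : N s < 0 := hsub ⟨((le_max_left _ _).trans ht.le).trans hs.1.le, hs.2.le⟩
      have h4 := hβ hs.1
      simp only [Pi.neg_apply]
      nlinarith) hty
  simp only [Pi.neg_apply, intervalIntegral.integral_neg] at h2
  linarith

variable {x b : ℝ}

/-- The reflection `s ↦ -s`, `β ↦ -β(-·)` keeps `β` increasing and exchanges the two ends. -/
theorem integral_comp_neg_sub_mul (t : ℝ) :
    ∫ s in (-t)..(-x), (-β (-s) - -β (- -t)) * N (-s) = ∫ s in x..t, (β t - β s) * N s := by
  rw [intervalIntegral.integral_comp_neg (fun s => (-β s - -β (- -t)) * N s), neg_neg, neg_neg]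
  congr 1; ext s; ring

theorem nonneg_of_integral_sub_mul_add' (hxb : x < b) (hβ : StrictMono β)
    (hN : ContinuousOn N (Icc x b)) {Φ : ℝ}
    (h : ∀ t ∈ Ioo x b, 0 ≤ (∫ s in x..t, (β t - β s) * N s) + (β t - β x) * Φ) : 0 ≤ Φ := by
  refine nonneg_of_integral_sub_mul_add (a := -b) (y := -x) (β := fun s => -β (-s))
    (N := fun s => N (-s)) (neg_lt_neg hxb) (fun s t hst => neg_lt_neg (hβ (neg_lt_neg hst)))
    (hN.comp continuous_neg.continuousOn fun s hs => ⟨by linarith [hs.2], by linarith [hs.1]⟩)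
    fun t ht => ?_
  have h1 := h (-t) ⟨by linarith [ht.2], by linarith [ht.1]⟩
  rw [← integral_comp_neg_sub_mul] at h1
  simp only [neg_neg] at h1 ⊢
  linarith

theorem nonneg_of_integral_sub_mul' (hxb : x < b) (hβ : StrictMono β)
    (hN : ContinuousOn N (Icc x b))
    (h : ∀ t ∈ Ioo x b, 0 ≤ ∫ s in x..t, (β t - β s) * N s) : 0 ≤ N x := by
  have := nonneg_of_integral_sub_mul (a := -b) (y := -x) (β := fun s => -β (-s))
    (N := fun s => N (-s)) (neg_lt_neg hxb) (fun s t hst => neg_lt_neg (hβ (neg_lt_neg hst)))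
    (hN.comp continuous_neg.continuousOn fun s hs => ⟨by linarith [hs.2], by linarith [hs.1]⟩)
    fun t ht => ?_
  · simpa using this
  have h1 := h (-t) ⟨by linarith [ht.2], by linarith [ht.1]⟩
  rw [← integral_comp_neg_sub_mul] at h1
  simpa only [neg_neg] using h1

end

/-! ### Necessity: testing delegation against deviations -/

namespace DelegationModel

variable {M : DelegationModel} {s₁ s₂ : ℝ}

/-- No delegation mechanism obtained by composing `best` with an incentive-compatible `τ` beats
delegation to `[s₁, s₂]`. -/
theorem DelegatingIsOptimal.payoff_sure_le (h : M.DelegatingIsOptimal (Icc s₁ s₂))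
    (hlt : M.lo < M.hi) (h12 : s₁ < s₂) {τ : ℝ → ℝ}
    (hτ : ∀ x y, M.tang (τ y) x ≤ M.tang (τ x) x) :
    M.payoff (fun s => sure (M.best (τ s))) ≤
      M.payoff (fun s => sure (M.best (max s₁ (min s s₂)))) := by
  obtain ⟨m, ⟨_, hopt⟩, hin, hout⟩ := h
  refine (hopt _ (M.isMechanism_sure hτ) (M.isIncentiveCompatible_sure hτ)).trans_eq ?_
  rw [payoff, payoff, M.integral_F hlt, M.integral_F hlt]
  refine intervalIntegral.integral_congr fun s hs => ?_
  rw [uIcc_of_le hlt.le] at hs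
  have : m s = sure (M.best (max s₁ (min s s₂))) := by
    refine Subtype.ext ?_
    change (m s : Measure ℝ) = _
    by_cases hsA : s ∈ Icc s₁ s₂
    · obtain ⟨a, ha, hma⟩ := hin s hsA
      rw [hma, ha.eq_best, min_eq_left hsA.2, max_eq_right hsA.1]
      rfl
    · obtain ⟨a, ha, hma⟩ := hout s ⟨hs, hsA⟩
      rw [hma, ha.eq_best_clamp h12.le]
      rfl
  simp only [this]

/-- When `n` is chosen so that the boundary utilities cancel, the change in payoff is a single
integral of the change in action. -/
theorem DelegatingIsOptimal.integral_sub_nonpos (h : M.DelegatingIsOptimal (Icc s₁ s₂))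
    (hlt : M.lo < M.hi) (h12 : s₁ < s₂) {τ : ℝ → ℝ}
    (hτ : ∀ x y, M.tang (τ y) x ≤ M.tang (τ x) x) (n : ℝ)
    (hb : (M.κ - n) * M.tang (τ M.lo) M.lo + n * M.tang (τ M.hi) M.hi =
      (M.κ - n) * M.tang (max s₁ (min M.lo s₂)) M.lo + n * M.tang (max s₁ (min M.hi s₂)) M.hi) :
    IntervalIntegrable (fun s => (M.best (τ s) - M.best (max s₁ (min s s₂))) * (M.tail s - n))
      volume M.lo M.hi ∧
    ∫ s in M.lo..M.hi, (M.best (τ s) - M.best (max s₁ (min s s₂))) * (M.tail s - n) ≤ 0 := by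
  have hτ0 := M.tang_clamp_le h12.le
  have hle := h.payoff_sure_le hlt h12 hτ
  rw [M.payoff_sure hlt hτ n, M.payoff_sure hlt hτ0 n] at hle
  have hN : ContinuousOn (fun s => M.tail s - n) (uIcc M.lo M.hi) := by
    rw [uIcc_of_le hlt.le]; exact (M.continuousOn_tail hlt).sub continuousOn_const
  have i1 := ((M.isSubgradientOn_tang hτ M.lo M.hi).intervalIntegrable hlt.le).mul_continuousOn hN
  have i0 := ((M.isSubgradientOn_tang hτ0 M.lo M.hi).intervalIntegrable hlt.le).mul_continuousOn hN
  simp_rw [sub_mul]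
  refine ⟨i1.sub i0, ?_⟩
  rw [intervalIntegral.integral_sub i1 i0]
  linarith

end DelegationModel

namespace DelegationModel

variable {M : DelegationModel} {s₁ s₂ : ℝ}

theorem DelegatingIsOptimal.integral_tail_nonpos (h : M.DelegatingIsOptimal (Icc s₁ s₂))
    (h1 : M.lo ≤ s₁) (h12 : s₁ < s₂) {s : ℝ} (hs : s ∈ Ioo s₂ M.hi) :
    ∫ x in s..M.hi, M.tail x ≤ 0 := by
  have hls : M.lo < s := h1.trans_lt (h12.trans hs.1)
  have hlt : M.lo < M.hi := hls.trans hs.2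
  -- The first best of `u` is offered in addition, with `s` indifferent between it and that of `s₂`.
  -- Exactly the types from `s` upwards switch; `n = 0` works because the utility of `lo` does not
  -- change.
  obtain ⟨u, hu, hus⟩ := M.exists_tang_eq_right (M.tang_lt hs.1.ne)
  have hτ := M.tang_split_le h12.le hs.1.le hu.le le_rfl hus.symm
  obtain ⟨hi, hle⟩ := h.integral_sub_nonpos hlt h12 hτ 0 (by simp [split, hls])
  have hsI : s ∈ Icc M.lo M.hi := ⟨hls.le, hs.2.le⟩
  rw [← intervalIntegral.integral_add_adjacent_intervals (b := s)
      (hi.mono_set (by rw [uIcc_of_le hlt.le]; exact uIcc_subset_Icc ⟨le_rfl, hlt.le⟩ hsI))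
      (hi.mono_set (by rw [uIcc_of_le hlt.le]; exact uIcc_subset_Icc hsI ⟨hlt.le, le_rfl⟩)),
    intervalIntegral.integral_congr_Ioo_of_le (g := fun _ => 0) hls.le (fun x hx => by
      simp [split, hx.2]),
    intervalIntegral.integral_congr_Ioo_of_le (g := fun x => (M.best u - M.best s₂) * M.tail x)
      hs.2.le (fun x hx => by
        simp only [split, if_neg hx.1.not_gt, sub_zero, max_eq_left (min_le_right x u),
          min_eq_right (hs.1.le.trans hx.1.le), max_eq_right h12.le]),
    intervalIntegral.integral_zero, zero_add, intervalIntegral.integral_const_mul] at hle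
  exact nonpos_of_mul_nonpos_right hle (sub_pos.2 (M.best_strictMono (hs.1.trans hu)))

theorem DelegatingIsOptimal.integral_kappa_sub_tail_nonpos
    (h : M.DelegatingIsOptimal (Icc s₁ s₂)) (h12 : s₁ < s₂) (h2 : s₂ ≤ M.hi) {s : ℝ}
    (hs : s ∈ Ioo M.lo s₁) : ∫ x in M.lo..s, (M.κ - M.tail x) ≤ 0 := by
  have hsh : s < M.hi := hs.2.trans (h12.trans_le h2)
  have hlt : M.lo < M.hi := hs.1.trans hsh
  -- Mirror image: the utility of `hi` does not change, hence `n = κ`.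
  obtain ⟨u, hu, hus⟩ := M.exists_tang_eq_left (M.tang_lt hs.2.ne')
  have hτ := M.tang_split_le le_rfl hu.le hs.2.le h12.le hus
  obtain ⟨hi, hle⟩ := h.integral_sub_nonpos hlt h12 hτ M.κ (by simp [split, hsh.not_gt])
  have hsI : s ∈ Icc M.lo M.hi := ⟨hs.1.le, hsh.le⟩
  rw [← intervalIntegral.integral_add_adjacent_intervals (b := s)
      (hi.mono_set (by rw [uIcc_of_le hlt.le]; exact uIcc_subset_Icc ⟨le_rfl, hlt.le⟩ hsI))
      (hi.mono_set (by rw [uIcc_of_le hlt.le]; exact uIcc_subset_Icc hsI ⟨hlt.le, le_rfl⟩)),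
    intervalIntegral.integral_congr_Ioo_of_le (a := s) (g := fun _ => 0) hsh.le (fun x hx => by
      simp [split, hx.1.not_gt]),
    intervalIntegral.integral_congr_Ioo_of_le
      (g := fun x => (M.best s₁ - M.best u) * (M.κ - M.tail x)) hs.1.le (fun x hx => by
        simp only [split, if_pos hx.2, max_eq_left (min_le_right x u),
          max_eq_left ((min_le_left x s₂).trans (hx.2.trans hs.2).le)]
        ring),
    intervalIntegral.integral_zero, add_zero, intervalIntegral.integral_const_mul] at hle
  exact nonpos_of_mul_nonpos_right hle (sub_pos.2 (M.best_strictMono (hu.trans hs.2)))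

/-- The deviation is delegation to `[s₁, t]`: types in `[t, s₂]` are pushed down to `best t`, and
all higher types move from `best s₂` to `best t`. -/
theorem DelegatingIsOptimal.integral_shrink_right (h : M.DelegatingIsOptimal (Icc s₁ s₂))
    (h1 : M.lo ≤ s₁) (h12 : s₁ < s₂) (h2 : s₂ ≤ M.hi) {t : ℝ} (ht : t ∈ Ioo s₁ s₂) :
    0 ≤ (∫ x in t..s₂, (M.best x - M.best t) * M.tail x) +
      (M.best s₂ - M.best t) * ∫ x in s₂..M.hi, M.tail x := by
  have hlt : M.lo < M.hi := h1.trans_lt (h12.trans_le h2)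
  obtain ⟨hi, hle⟩ := h.integral_sub_nonpos hlt h12 (M.tang_clamp_le ht.1.le) 0 (by
    simp [min_eq_left (h1.trans ht.1.le), min_eq_left (h1.trans h12.le)])
  have htI : t ∈ Icc M.lo M.hi := ⟨h1.trans ht.1.le, ht.2.le.trans h2⟩
  have h2I : s₂ ∈ Icc M.lo M.hi := ⟨h1.trans h12.le, h2⟩
  have hi' : ∀ {x y}, x ∈ Icc M.lo M.hi → y ∈ Icc M.lo M.hi → IntervalIntegrable
      (fun s => (M.best (max s₁ (min s t)) - M.best (max s₁ (min s s₂))) * (M.tail s - 0))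
      volume x y := fun hx hy =>
    hi.mono_set (by rw [uIcc_of_le hlt.le]; exact uIcc_subset_Icc hx hy)
  rw [← intervalIntegral.integral_add_adjacent_intervals (hi' ⟨le_rfl, hlt.le⟩ htI)
      (hi' htI ⟨hlt.le, le_rfl⟩),
    ← intervalIntegral.integral_add_adjacent_intervals (hi' htI h2I) (hi' h2I ⟨hlt.le, le_rfl⟩),
    intervalIntegral.integral_congr_Ioo_of_le (g := fun _ => 0) htI.1 (fun x hx => by
      simp [min_eq_left hx.2.le, min_eq_left (hx.2.trans ht.2).le]),
    intervalIntegral.integral_congr_Ioo_of_le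
      (g := fun x => -((M.best x - M.best t) * M.tail x)) ht.2.le (fun x hx => by
        simp only [min_eq_right hx.1.le, min_eq_left hx.2.le, max_eq_right ht.1.le,
          max_eq_right (ht.1.trans hx.1).le]
        ring),
    intervalIntegral.integral_congr_Ioo_of_le
      (g := fun x => -(M.best s₂ - M.best t) * M.tail x) h2 (fun x hx => by
        simp only [min_eq_right (ht.2.trans hx.1).le, min_eq_right hx.1.le, max_eq_right ht.1.le,
          max_eq_right h12.le]
        ring),
    intervalIntegral.integral_zero, zero_add, intervalIntegral.integral_const_mul,
    intervalIntegral.integral_neg] at hle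
  linarith

theorem DelegatingIsOptimal.integral_shrink_left (h : M.DelegatingIsOptimal (Icc s₁ s₂))
    (h1 : M.lo ≤ s₁) (h12 : s₁ < s₂) (h2 : s₂ ≤ M.hi) {t : ℝ} (ht : t ∈ Ioo s₁ s₂) :
    0 ≤ (∫ x in s₁..t, (M.best t - M.best x) * (M.κ - M.tail x)) +
      (M.best t - M.best s₁) * ∫ x in M.lo..s₁, (M.κ - M.tail x) := by
  have hlt : M.lo < M.hi := h1.trans_lt (h12.trans_le h2)
  obtain ⟨hi, hle⟩ := h.integral_sub_nonpos hlt h12 (M.tang_clamp_le ht.2.le) M.κ (by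
    simp [min_eq_right h2, max_eq_right ht.2.le, max_eq_right h12.le])
  have htI : t ∈ Icc M.lo M.hi := ⟨h1.trans ht.1.le, ht.2.le.trans h2⟩
  have h1I : s₁ ∈ Icc M.lo M.hi := ⟨h1, h12.le.trans h2⟩
  have hi' : ∀ {x y}, x ∈ Icc M.lo M.hi → y ∈ Icc M.lo M.hi → IntervalIntegrable
      (fun s => (M.best (max t (min s s₂)) - M.best (max s₁ (min s s₂))) * (M.tail s - M.κ))
      volume x y := fun hx hy =>
    hi.mono_set (by rw [uIcc_of_le hlt.le]; exact uIcc_subset_Icc hx hy)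
  rw [← intervalIntegral.integral_add_adjacent_intervals (hi' ⟨le_rfl, hlt.le⟩ h1I)
      (hi' h1I ⟨hlt.le, le_rfl⟩),
    ← intervalIntegral.integral_add_adjacent_intervals (hi' h1I htI) (hi' htI ⟨hlt.le, le_rfl⟩),
    intervalIntegral.integral_congr_Ioo_of_le (a := t) (g := fun _ => 0) htI.2 (fun x hx => by
      have hx' : t ≤ min x s₂ := le_min hx.1.le ht.2.le
      simp [max_eq_right hx', max_eq_right (ht.1.le.trans hx')]),
    intervalIntegral.integral_congr_Ioo_of_le (a := s₁)
      (g := fun x => -((M.best t - M.best x) * (M.κ - M.tail x))) ht.1.le (fun x hx => by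
        simp only [min_eq_left (hx.2.trans ht.2).le, max_eq_left hx.2.le, max_eq_right hx.1.le]
        ring),
    intervalIntegral.integral_congr_Ioo_of_le
      (g := fun x => -(M.best t - M.best s₁) * (M.κ - M.tail x)) h1 (fun x hx => by
        simp only [min_eq_left (hx.2.trans h12).le, max_eq_left (hx.2.trans ht.1).le,
          max_eq_left hx.2.le]
        ring),
    intervalIntegral.integral_zero, add_zero, intervalIntegral.integral_const_mul,
    intervalIntegral.integral_neg] at hle
  linarith

theorem DelegatingIsOptimal.nu_nonneg_of_mem_Ioo (h : M.DelegatingIsOptimal (Icc s₁ s₂))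
    (h1 : M.lo ≤ s₁) (h2 : s₂ ≤ M.hi) {c : ℝ} (hc : c ∈ Ioo s₁ s₂) : 0 ≤ M.nu c := by
  have h12 : s₁ < s₂ := hc.1.trans hc.2
  have hlt : M.lo < M.hi := h1.trans_lt (h12.trans_le h2)
  have hcI : c ∈ Ioo M.lo M.hi := ⟨h1.trans_lt hc.1, hc.2.trans_le h2⟩
  by_contra! hneg
  -- If `nu c < 0`, then `tail` has positive derivative at `c`, so `tail x - tail c` has the sign of
  -- `x - c` near `c`.
  obtain ⟨ε, hε, hslope⟩ : ∃ ε > 0, ∀ x, |x - c| < ε → x ≠ c →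
      0 < (x - c) * (M.tail x - M.tail c) := by
    have hev := (hasDerivAt_iff_tendsto_slope.1 (M.hasDerivAt_tail hcI)).eventually_const_lt
      (neg_pos.2 hneg)
    obtain ⟨ε, hε, hsub⟩ := Metric.mem_nhdsWithin_iff.1 hev
    refine ⟨ε, hε, fun x hx hxc => ?_⟩
    have h3 : 0 < slope M.tail c x := hsub ⟨by rwa [Metric.mem_ball, Real.dist_eq], hxc⟩
    rw [slope_def_field] at h3
    have h4 : 0 < (x - c) ^ 2 := by have := sub_ne_zero.2 hxc; positivity
    have h5 := mul_pos h3 h4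
    have h6 : (M.tail x - M.tail c) / (x - c) * (x - c) ^ 2 = (x - c) * (M.tail x - M.tail c) := by
      have := sub_ne_zero.2 hxc
      field_simp
    rwa [h6] at h5
  obtain ⟨t₀, ht₀, ht₀c⟩ := exists_between (max_lt hc.1 (sub_lt_self c hε))
  obtain ⟨u₀, hcu₀, hu₀⟩ := exists_between (lt_min hc.2 (lt_add_of_pos_right c hε))
  -- The larger of the two values is a utility level that type `c` attains on both sides, which
  -- gives endpoints `t < c < u` of a gap with `c` indifferent.
  have hymax : max (M.tang t₀ c) (M.tang u₀ c) < M.tang c c :=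
    max_lt (M.tang_lt ht₀c.ne) (M.tang_lt hcu₀.ne')
  obtain ⟨t, ht, hty⟩ := intermediate_value_Icc ht₀c.le (M.continuous_tang c).continuousOn
    ⟨le_max_left _ _, hymax.le⟩
  obtain ⟨u, hu, huy⟩ := intermediate_value_Icc' hcu₀.le (M.continuous_tang c).continuousOn
    ⟨le_max_right _ _, hymax.le⟩
  have htc : t < c := ht.2.lt_of_ne (by rintro rfl; exact hymax.ne' hty)
  have hcu : c < u := hu.1.lt_of_ne (by rintro rfl; exact hymax.ne' huy)
  have hs₁t : s₁ ≤ t := ((le_max_left _ _).trans ht₀.le).trans ht.1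
  have hus₂ : u ≤ s₂ := hu.2.trans (hu₀.le.trans (min_le_left _ _))
  have hct : c - ε < t := ((le_max_right _ _).trans_lt ht₀).trans_le ht.1
  have huc : u < c + ε := hu.2.trans_lt (hu₀.trans_le (min_le_right _ _))
  -- Both end types keep their utilities, so `n` is arbitrary; with `n = tail c` the change of
  -- action and `tail - n` have the same sign throughout the gap.
  obtain ⟨hi, hle⟩ := h.integral_sub_nonpos hlt h12
    (M.tang_split_le hs₁t htc.le hcu.le hus₂ (hty.trans huy.symm)) (M.tail c) (by
      simp only [split, if_pos hcI.1, if_neg hcI.2.not_gt, min_eq_right h2, max_eq_right hus₂,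
        max_eq_right h12.le, min_eq_left (h1.trans (hs₁t)), min_eq_left (h1.trans h12.le)])
  have hG : ∀ x, t < x → x < c →
      0 < (M.best (split s₁ t c u s₂ x) - M.best (max s₁ (min x s₂))) * (M.tail x - M.tail c) := by
    intro x hx hxc
    have h3 := hslope x (by rw [abs_lt]; constructor <;> linarith) hxc.ne
    have h4 := M.best_strictMono hx
    rw [split, if_pos hxc, min_eq_right hx.le, max_eq_right hs₁t, min_eq_left (hxc.trans hc.2).le,
      max_eq_right (hs₁t.trans hx.le)]
    have h5 : M.tail x - M.tail c < 0 := by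
      by_contra! h6
      nlinarith
    exact mul_pos_of_neg_of_neg (sub_neg.2 h4) h5
  have hG0 : ∀ x,
      0 ≤ (M.best (split s₁ t c u s₂ x) - M.best (max s₁ (min x s₂))) * (M.tail x - M.tail c) := by
    intro x
    rcases lt_or_ge x c with hxc | hxc
    · rcases le_or_gt x t with hxt | hxt
      · rw [split, if_pos hxc, min_eq_left hxt, min_eq_left (hxc.trans hc.2).le]
        simp
      · exact (hG x hxt hxc).le
    rcases hxc.eq_or_lt with rfl | hxc
    · simp
    rcases lt_or_ge x u with hxu | hxu
    · have h3 := hslope x (by rw [abs_lt]; constructor <;> linarith) hxc.ne'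
      have h4 := M.best_strictMono hxu
      have hxs : x ≤ s₂ := hxu.le.trans hus₂
      rw [split, if_neg hxc.not_gt, min_eq_left hxs, max_eq_left hxu.le,
        max_eq_right (hc.1.trans hxc).le]
      exact mul_nonneg (sub_nonneg.2 h4.le) (pos_of_mul_pos_right h3 (sub_pos.2 hxc).le).le
    · have hx' : u ≤ min x s₂ := le_min hxu hus₂
      rw [split, if_neg hxc.not_gt, max_eq_right hx', max_eq_right ((hc.1.trans hcu).le.trans hx')]
      simp
  have hpos := intervalIntegral.intervalIntegral_pos_of_pos_on
    (hi.mono_set (by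
      rw [uIcc_of_le hlt.le]
      exact uIcc_subset_Icc ⟨h1.trans hs₁t, htc.le.trans hcI.2.le⟩ (Ioo_subset_Icc_self hcI)))
    (fun x hx => hG x hx.1 hx.2) htc
  have := intervalIntegral.integral_mono_interval (h1.trans hs₁t) htc.le hcI.2.le
    (Eventually.of_forall hG0) hi
  linarith

theorem DelegatingIsOptimal.tailConditions (h : M.DelegatingIsOptimal (Icc s₁ s₂))
    (h1 : M.lo ≤ s₁) (h12 : s₁ < s₂) (h2 : s₂ ≤ M.hi) : M.TailConditions s₁ s₂ := by
  have hlt : M.lo < M.hi := h1.trans_lt (h12.trans_le h2)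
  have hN : ContinuousOn M.tail (Icc s₁ s₂) := (M.continuousOn_tail hlt).mono (Icc_subset_Icc h1 h2)
  have hQ : ContinuousOn (fun x => M.κ - M.tail x) (Icc s₁ s₂) := continuousOn_const.sub hN
  have hNi := M.intervalIntegrable_tail hlt (left_mem_Icc.2 hlt.le) (right_mem_Icc.2 hlt.le)
  have hQi : IntervalIntegrable (fun x => M.κ - M.tail x) volume M.lo M.hi :=
    (by simp : IntervalIntegrable (fun _ => M.κ) volume _ _).sub hNi
  have hright0 : 0 ≤ ∫ x in s₂..M.hi, M.tail x :=
    nonneg_of_integral_sub_mul_add h12 M.best_strictMono hN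
      fun t ht => h.integral_shrink_right h1 h12 h2 ht
  have hleft0 : 0 ≤ ∫ x in M.lo..s₁, (M.κ - M.tail x) :=
    nonneg_of_integral_sub_mul_add' h12 M.best_strictMono hQ
      fun t ht => h.integral_shrink_left h1 h12 h2 ht
  have hright : ∀ s ∈ Icc s₂ M.hi, ∫ x in s..M.hi, M.tail x ≤ 0 := by
    intro s hs
    rcases hs.2.eq_or_lt with rfl | hsh
    · simp
    have hcont : ContinuousOn (fun t => ∫ x in t..M.hi, M.tail x) (Icc M.lo M.hi) := by
      have := intervalIntegral.continuousOn_primitive_interval' hNi right_mem_uIcc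
      rw [uIcc_of_le hlt.le] at this
      refine this.neg.congr fun t _ => ?_
      exact intervalIntegral.integral_symm _ _
    have hsub : Ioo s M.hi ⊆ Icc M.lo M.hi := fun t ht =>
      ⟨(h1.trans (h12.le.trans hs.1)).trans ht.1.le, ht.2.le⟩
    have := left_nhdsWithin_Ioo_neBot hsh
    -- The deviation needs `s` strictly above `s₂`; continuity from the right covers `s = s₂`.
    refine le_of_tendsto ((hcont s ⟨h1.trans (h12.le.trans hs.1), hs.2⟩).mono hsub)
      (eventually_mem_nhdsWithin.mono fun t ht => ?_)
    exact h.integral_tail_nonpos h1 h12 ⟨hs.1.trans_lt ht.1, ht.2⟩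
  have hleft : ∀ s ∈ Icc M.lo s₁, ∫ x in M.lo..s, (M.κ - M.tail x) ≤ 0 := by
    intro s hs
    rcases hs.1.eq_or_lt with rfl | hsl
    · simp
    have hcont : ContinuousOn (fun t => ∫ x in M.lo..t, (M.κ - M.tail x)) (Icc M.lo M.hi) := by
      have := intervalIntegral.continuousOn_primitive_interval' hQi left_mem_uIcc
      rwa [uIcc_of_le hlt.le] at this
    have hsh : s ≤ M.hi := hs.2.trans (h12.le.trans h2)
    have hsub : Ioo M.lo s ⊆ Icc M.lo M.hi := fun t ht => ⟨ht.1.le, ht.2.le.trans hsh⟩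
    have := right_nhdsWithin_Ioo_neBot hsl
    refine le_of_tendsto ((hcont s ⟨hs.1, hsh⟩).mono hsub)
      (eventually_mem_nhdsWithin.mono fun t ht => ?_)
    exact h.integral_kappa_sub_tail_nonpos h12 h2 ⟨ht.1, ht.2.trans_le hs.2⟩
  have hanti : AntitoneOn M.tail (Icc s₁ s₂) := by
    have hd : ∀ x ∈ Ioo s₁ s₂, HasDerivAt M.tail (-M.nu x) x := fun x hx =>
      M.hasDerivAt_tail ⟨h1.trans_lt hx.1, hx.2.trans_le h2⟩
    refine antitoneOn_of_deriv_nonpos (convex_Icc _ _) hN ?_ ?_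
    · rw [interior_Icc]
      exact fun x hx => (hd x hx).differentiableAt.differentiableWithinAt
    · rw [interior_Icc]
      intro x hx
      rw [(hd x hx).deriv]
      exact neg_nonpos.2 (h.nu_nonneg_of_mem_Ioo h1 h2 hx)
  refine ⟨fun s hs => ?_, ⟨hright, (hright s₂ ⟨le_rfl, h2⟩).antisymm hright0⟩,
    hleft, (hleft s₁ ⟨h1, le_rfl⟩).antisymm hleft0⟩
  -- At `lo` or `hi` the value of `nu` is an atom. There the integral outside the interval is over a
  -- single point, so trimming alone determines the sign.
  rcases (h1.trans hs.1).eq_or_lt with hsl | hsl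
  · obtain rfl : M.lo = s₁ := h1.antisymm (hsl ▸ hs.1)
    rw [← hsl, M.nu_lo hlt]
    refine nonneg_of_integral_sub_mul' (N := fun x => M.κ - M.tail x) h12 M.best_strictMono hQ fun t ht => ?_
    simpa using h.integral_shrink_left h1 h12 h2 ht
  rcases (hs.2.trans h2).eq_or_lt with hsh | hsh
  · obtain rfl : s₂ = M.hi := h2.antisymm (hsh ▸ hs.2)
    rw [hsh, M.nu_hi hlt]
    refine nonneg_of_integral_sub_mul h12 M.best_strictMono hN fun t ht => ?_
    simpa using h.integral_shrink_right h1 h12 h2 ht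
  -- `nu` may be discontinuous, so its sign at `s₁` and `s₂` comes from the one-sided derivative of
  -- the antitone `tail`, which equals `-nu s` since `s` is interior to `S`.
  have := hanti.derivWithin_nonpos (x := s)
  rw [(M.hasDerivAt_tail ⟨hsl, hsh⟩).hasDerivWithinAt.derivWithin
    (uniqueDiffOn_Icc h12 s hs)] at this
  linarith

end DelegationModel

theorem corollary1 (M : DelegationModel) (hν : MeasureTheory.Integrable M.nu M.lam)
    (s₁ s₂ : ℝ) (hs₁ : s₁ ∈ M.S) (hs₂ : s₂ ∈ M.S) (h12 : s₁ < s₂) :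
    M.DelegatingIsOptimal (Set.Icc s₁ s₂) ↔
      (∀ s ∈ Set.Icc s₁ s₂, 0 ≤ M.nu s) ∧
      ((∀ s ∈ Set.Icc s₂ M.hi,
          ∫ x in Set.Icc s M.hi, (x - s) * M.nu x ∂(ProbabilityTheory.cond M.lam (Set.Ici s₂)) ≤ 0) ∧
        ∫ x in Set.Icc s₂ M.hi,
          (x - s₂) * M.nu x ∂(ProbabilityTheory.cond M.lam (Set.Ici s₂)) = 0) ∧
      ((∀ s ∈ Set.Icc M.lo s₁,
          ∫ x in Set.Icc M.lo s, (s - x) * M.nu x ∂(ProbabilityTheory.cond M.lam (Set.Iic s₁)) ≤ 0) ∧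
        ∫ x in Set.Icc M.lo s₁,
          (s₁ - x) * M.nu x ∂(ProbabilityTheory.cond M.lam (Set.Iic s₁)) = 0) := by
  rw [← M.tailConditions_iff hν hs₁ hs₂ h12]
  exact ⟨fun h => h.tailConditions hs₁.1 h12 hs₂.2, fun h =>
    h.delegatingIsOptimal hν (hs₁.1.trans_lt (h12.trans_le hs₂.2)) hs₁.1 h12 hs₂.2⟩
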